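/- Let $(K,L)$ be a finite Gelfand pair: $K$ is a finite group, $L\le K$, and with $e_L=\frac1{|L|}\sum_{h\in L}h$ the Hecke algebra $e_L\,\mathbb{C}K\,e_L$ is commutative. Let $\mathbb{C}Ke_L=\bigoplus_{i=0}^{s-1}V_i$ be the decomposition into irreducible $K$-modules, $d_i=\dim V_i$, and let $\omega_i(g)=\frac1{|L|}\sum_{h\in L}\overline{\chi_{V_i}(gh)}$ be the zonal spherical function afforded by $V_i$. Fix $x_0\in K\setminus L$ and put $D_0=Lx_0L$, $m=|D_0|/|L|$, $r=|K|/|L|$. Let $n\ge 1$ and let $p$ be a real number with $0\le mp\le 1$. For $x\in K^n$ write $\overline{x}=xL^n\in (K/L)^n$. Let $P=P_{(K,L;n)}$ be the matrix indexed by $(K/L)^n$ with entries $$p(\overline x,\overline y)=\begin{cases}1-mp & x^{-1}y\in L^n,\\ p/n & x^{-1}y\in L^{j}\times D_0\times L^{n-j-1}\text{ for some }0\le j<n,\\ 0&\text{otherwise.}\end{cases}$$ Let $\overline e$ be the class of the identity, let $\nu_N(\overline x)$ be the $(\overline e,\overline x)$ entry of $P^N$, and for $g=(g_1,\dots,g_n;\sigma)\in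 K\wr S_n$ let $\overline g=(g_1L,\dots,g_nL)$ and $\tilde\nu(g)=\frac{1}{|L|^n\,n!}\,p(\overline e,\overline g)$. Let $X(s,n)=\{k\in\mathbb{Z}_{\ge0}^s : k_0+\cdots+k_{s-1}=n\}$, $\binom nk=\frac{n!}{k_0!\cdots k_{s-1}!}$, $d_k=d_0^{k_0}\cdots d_{s-1}^{k_{s-1}}\binom nk$, and for $k\in X(s,n)$ let the multivariate Krawtchouk polynomial $\Omega_k$ be the function on $K\wr S_n$ defined by $$\prod_{i=1}^n\Big(\sum_{j=0}^{s-1}\omega_j(x_i)t_j\Big)=\sum_{k\in X(s,n)}\binom nk\,\Omega_k(x)\,t^k,\qquad x=(x_1,\dots,x_n;\sigma).$$ Then the following hold. 1. $(K\wr S_n,L\wr S_n)$ is a Gelfand pair, and the permutation module $\mathbb{C}[K\wr S_n]\,e_{L\wr S_n}$ is a direct sum of irreducible modules $W_k$, $k\in X(s,n)$, such that $W_k$ has dimension $d_k$ and its zonal spherical function is $\Omega_k$. 2. There are numbers $f(k)$ $(k\in X(s,n))$, the Fourier coefficients, with $$\tilde\nu=\sum_{k\in X(s,n)}\frac{d_k}{|K\wr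 S_n|}\,f(k)\,\Omega_k ,$$ and any such numbers are given by $$f(k)=(1-mp)+mp\sum_{i=0}^{s-1}\frac{k_i}{n}\,\overline{\omega_i(x_0)}\qquad(k\in X(s,n)).$$ 3. For every $N\ge0$ and $g\in K\wr S_n$, $$\nu_N(\overline g)=\frac1{r^n}\sum_{k\in X(s,n)}d_k\,f(k)^N\,\Omega_k(g).$$ -/

import Mathlib

noncomputable section

namespace UrnWalk

/-! ### Finite Gelfand pairs and their zonal spherical functions -/

section Gelfand

variable {K : Type*} [Group K]

/-- The idempotent `e_L = (1/|L|) ∑_{h ∈ L} h` of the group algebra `ℂK`. -/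
def idem (L : Subgroup K) : MonoidAlgebra ℂ K :=
  (Nat.card L : ℂ)⁻¹ • ∑ᶠ h : L, MonoidAlgebra.single (h : K) (1 : ℂ)

/-- `(K, L)` is a Gelfand pair: the Hecke algebra `e_L ℂK e_L` is commutative. -/
def IsGelfandPair (L : Subgroup K) : Prop :=
  ∀ a b : MonoidAlgebra ℂ K,
    (idem L * a * idem L) * (idem L * b * idem L) =
      (idem L * b * idem L) * (idem L * a * idem L)

/-- The permutation module `ℂK e_L`, as a left ideal of `ℂK`. -/
def permModule (L : Subgroup K) : Ideal (MonoidAlgebra ℂ K) :=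
  Ideal.span {idem L}

/-- `ℂK e_L = ⨁ i, V i` with every `V i` an irreducible `K`-module. -/
structure IsIrredDecomp (L : Subgroup K) {ι : Type*}
    (V : ι → Ideal (MonoidAlgebra ℂ K)) : Prop where
  simple : ∀ i, IsSimpleModule (MonoidAlgebra ℂ K) (V i)
  indep : iSupIndep V
  iSup_eq : ⨆ i, V i = permModule L

/-- The character of the `K`-module `V`. -/
def character (V : Ideal (MonoidAlgebra ℂ K)) (g : K) : ℂ :=
  LinearMap.trace ℂ V (Algebra.lsmul ℂ ℂ V (MonoidAlgebra.single g (1 : ℂ)))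

/-- The zonal spherical function afforded by `V`:
`ω(g) = (1/|L|) ∑_{h ∈ L} conj (χ_V (g h))`. -/
def zonal (L : Subgroup K) (V : Ideal (MonoidAlgebra ℂ K)) (g : K) : ℂ :=
  (Nat.card L : ℂ)⁻¹ * ∑ᶠ h : L, starRingEnd ℂ (character V (g * (h : K)))

end Gelfand

/-! ### Wreath products with the symmetric group -/

section Wreath

variable (K : Type*) [Group K] (n : ℕ)

/-- The permutation action of `S_n` on `K^n`: `(σ • g) i = g (σ⁻¹ i)`. -/
def permAct : Equiv.Perm (Fin n) →* MulAut (Fin n → K) where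
  toFun σ := MulEquiv.arrowCongr σ (MulEquiv.refl K)
  map_one' := rfl
  map_mul' _ _ := rfl

/-- The wreath product `K ≀ S_n`, with product
`(g; σ) (g'; σ') = (i ↦ g i * g' (σ⁻¹ i); σ σ')`. -/
abbrev Wreath : Type _ := (Fin n → K) ⋊[permAct K n] Equiv.Perm (Fin n)

variable {K}

/-- The subgroup `L ≀ S_n` of `K ≀ S_n`. -/
def wreathSubgroup (L : Subgroup K) : Subgroup (Wreath K n) where
  carrier := {x | ∀ i, x.left i ∈ L}
  one_mem' _ := L.one_mem
  mul_mem' {a _b} ha hb i := L.mul_mem (ha i) (hb (a.right⁻¹ i))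
  inv_mem' {a} ha i := L.inv_mem (ha (a.right i))

end Wreath

/-! ### Multivariate Krawtchouk polynomials -/

section Krawtchouk

variable {K : Type*} [Group K]

/-- `X(s,n)`: the tuples `(k_0, …, k_{s-1})` of natural numbers with sum `n`. -/
abbrev Comp (s n : ℕ) : Type :=
  {k : Fin s → ℕ // k ∈ Finset.piAntidiag (Finset.univ : Finset (Fin s)) n}

/-- The multinomial coefficient `n! / (k_0! ⋯ k_{s-1}!)`. -/
def multinom {s n : ℕ} (k : Comp s n) : ℕ := Nat.multinomial Finset.univ k.1

/-- The generating polynomial `Φ(x) = ∏_i (∑_j ω_j(x_i) t_j)` for `x = (x_1, …, x_n; σ)`. -/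
def genPoly (L : Subgroup K) {s : ℕ} (V : Fin s → Ideal (MonoidAlgebra ℂ K)) {n : ℕ}
    (x : Wreath K n) : MvPolynomial (Fin s) ℂ :=
  ∏ i : Fin n, ∑ j : Fin s, MvPolynomial.C (zonal L (V j) (x.left i)) * MvPolynomial.X j

/-- The multivariate Krawtchouk polynomial `Ω_k`, as a function on `K ≀ S_n`:
the coefficient of `t^k` in `Φ(x)` is `multinom k * Ω_k(x)`. -/
def Omega (L : Subgroup K) {s : ℕ} (V : Fin s → Ideal (MonoidAlgebra ℂ K)) {n : ℕ}
    (k : Comp s n) (x : Wreath K n) : ℂ :=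
  (genPoly L V x).coeff (Finsupp.equivFunOnFinite.symm k.1) / (multinom k : ℂ)

/-- `d_k = d_0^{k_0} ⋯ d_{s-1}^{k_{s-1}} * multinom k`, where `d_i = dim V_i`. -/
def dimK {s : ℕ} (V : Fin s → Ideal (MonoidAlgebra ℂ K)) {n : ℕ} (k : Comp s n) : ℕ :=
  (∏ i, Module.finrank ℂ (V i) ^ k.1 i) * multinom k

end Krawtchouk

/-! ### The random walk on `(K/L)^n` -/

section Walk

variable {K : Type*} [Group K] (L : Subgroup K) (x₀ : K) (n : ℕ) (p : ℝ)

/-- `m = |D₀| / |L|`, where `D₀ = L x₀ L`. -/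
def mult : ℝ := (Nat.card (DoubleCoset.doubleCoset x₀ (L : Set K) (L : Set K)) : ℝ) / Nat.card L

/-- `x̄ = x L^n`, as an element of `(K/L)^n`. -/
def bar {n : ℕ} (x : Fin n → K) : Fin n → K ⧸ L := fun i => (x i : K ⧸ L)

open scoped Classical in
/-- The matrix `P_{(K,L;n)}`: the entry at `(x̄, ȳ)` is `1 - m p` if `x⁻¹ y ∈ L^n`,
`p / n` if `x⁻¹ y ∈ L^k × D₀ × L^{n-k-1}` for some `0 ≤ k < n`, and `0` otherwise. -/
def stepMatrix : Matrix (Fin n → K ⧸ L) (Fin n → K ⧸ L) ℝ := fun X Y =>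
  if ∃ x y : Fin n → K, bar L x = X ∧ bar L y = Y ∧ ∀ i, (x i)⁻¹ * y i ∈ L then
    1 - mult L x₀ * p
  else if ∃ x y : Fin n → K, bar L x = X ∧ bar L y = Y ∧
      ∃ k, (x k)⁻¹ * y k ∈ DoubleCoset.doubleCoset x₀ (L : Set K) (L : Set K) ∧
        ∀ i, i ≠ k → (x i)⁻¹ * y i ∈ L then
    p / n
  else 0

open scoped Classical in
/-- The `N`-step probability `ν_N(x̄)`: the `(ē, x̄)` entry of `P_{(K,L;n)}^N`. -/
def nu [Finite K] (N : ℕ) (X : Fin n → K ⧸ L) : ℝ :=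
  letI : Fintype (K ⧸ L) := Fintype.ofFinite _
  (stepMatrix L x₀ n p ^ N) (bar L fun _ => (1 : K)) X

/-- The image of `g = (g_1, …, g_n; σ)` under the natural identification of
`K ≀ S_n / L ≀ S_n` with `(K/L)^n`, namely `g • ē = (g_1 L, …, g_n L)`. -/
def orbitPt {n : ℕ} (g : Wreath K n) : Fin n → K ⧸ L := bar L g.left

/-- The lift `ν̃(g) = ν(ḡ) / (|L|^n n!)` to `K ≀ S_n` of the one-step law
`ν(x̄) = p(ē, x̄)`. -/
def nuTilde (g : Wreath K n) : ℂ :=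
  (stepMatrix L x₀ n p (bar L fun _ => (1 : K)) (orbitPt L g) : ℂ) /
    ((Nat.card L : ℂ) ^ n * (Nat.factorial n : ℂ))

/-- `f` is a family of Fourier coefficients of the walk:
`ν̃ = ∑_k (d_k / |K ≀ S_n|) f(k) Ω_k`. -/
def IsFourierCoeff {s : ℕ} (V : Fin s → Ideal (MonoidAlgebra ℂ K)) (f : Comp s n → ℂ) : Prop :=
  ∀ g : Wreath K n, nuTilde L x₀ n p g =
    ∑ k : Comp s n, ((dimK V k : ℂ) / (Nat.card (Wreath K n) : ℂ)) * f k * Omega L V k g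

end Walk

end UrnWalk

end

set_option linter.unusedSectionVars false

noncomputable section

namespace UrnWalk

/-! ### The group algebra of a finite group -/

section GroupAlgebra

variable {G : Type*} [Group G] [Fintype G]

/-! Everything is translated into idempotents. For a Gelfand pair the components of `e_L` in the `V
i` are orthogonal idempotents `ε i` with `V i = ℂK (ε i)`, `ε i * ℂK * ε j = 0` for `i ≠ j`, and `ε
i * ℂK * ε i = ℂ (ε i)`. This is `IsHeckeSystem`, obtained from commutativity and Schur's lemma.
From it alone, `dim V_i = |K| ε_i(1)` (`finrank_eq`) and `ω_i(g) = ε_i(g) / ε_i(1)` (`zonal_eq`),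
while `isGelfandPair` and `isIrredDecomp` recover the Gelfand property and the decomposition.

For the wreath product, the pure tensors `ε_{i_1} ⊗ ⋯ ⊗ ε_{i_n}` are summed over the words of type
`k`, pulled back from `K^n` and divided by `n!`. These elements form a Hecke system for `L ≀ S_n`
(`IsHeckeSystem.wreath`), because an `L ≀ S_n`-bi-invariant function is a symmetric
`L^n`-bi-invariant function on `K^n`. Expanding the generating polynomial over words identifies
their normalized coefficients with `Ω_k`.

The indicator of `D₀` is `|D₀| e_L x₀ e_L = |D₀| ∑ conj (ω_i(x₀)) ε_i`. Hence `P` acts as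
convolution by a combination of the symmetrized tensors (`stepMatrix_eq`), and its coefficients are
the `f(k)`. Orthogonality gives both the uniqueness of the `f(k)` and the powers `f(k)^N`. -/

/-- The element `∑ g, f g • g` of the group algebra. -/
def ofFun (f : G → ℂ) : MonoidAlgebra ℂ G :=
  MonoidAlgebra.ofCoeff (Finsupp.equivFunOnFinite.symm f)

@[simp]
theorem coeff_ofFun (f : G → ℂ) (g : G) : (ofFun f).coeff g = f g := rfl

theorem algebra_ext {a b : MonoidAlgebra ℂ G} (h : ∀ g, a.coeff g = b.coeff g) : a = b :=
  MonoidAlgebra.ext (Finsupp.ext h)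

theorem coeff_mul_eq_sum (a b : MonoidAlgebra ℂ G) (g : G) :
    (a * b).coeff g = ∑ x, a.coeff x * b.coeff (x⁻¹ * g) := by
  rw [MonoidAlgebra.coeff_mul_apply_left, Finsupp.sum_fintype]
  simp

theorem eq_sum_single (a : MonoidAlgebra ℂ G) :
    a = ∑ x, a.coeff x • MonoidAlgebra.single x (1 : ℂ) := by
  classical
  refine algebra_ext fun g => ?_
  simp [MonoidAlgebra.coeff_sum]

theorem coeff_mul_one_comm (a b : MonoidAlgebra ℂ G) :
    (a * b).coeff 1 = (b * a).coeff 1 := by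
  rw [coeff_mul_eq_sum, coeff_mul_eq_sum]
  refine Fintype.sum_equiv (Equiv.inv G) _ _ fun x => ?_
  simp [mul_comm]

/-- The conjugate-linear involution `a ↦ a*` with `a*(g) = conj (a (g⁻¹))`. -/
def adj (a : MonoidAlgebra ℂ G) : MonoidAlgebra ℂ G :=
  ofFun fun g => starRingEnd ℂ (a.coeff g⁻¹)

@[simp]
theorem coeff_adj (a : MonoidAlgebra ℂ G) (g : G) :
    (adj a).coeff g = starRingEnd ℂ (a.coeff g⁻¹) := rfl

@[simp]
theorem adj_adj (a : MonoidAlgebra ℂ G) : adj (adj a) = a :=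
  algebra_ext fun g => by simp

theorem adj_mul (a b : MonoidAlgebra ℂ G) : adj (a * b) = adj b * adj a := by
  refine algebra_ext fun g => ?_
  rw [coeff_adj, coeff_mul_eq_sum, coeff_mul_eq_sum, map_sum]
  refine Fintype.sum_equiv (Equiv.mulLeft g) _ _ fun x => ?_
  simp [mul_comm]

theorem adj_smul (c : ℂ) (a : MonoidAlgebra ℂ G) : adj (c • a) = starRingEnd ℂ c • adj a :=
  algebra_ext fun g => by simp

/-- The squared `ℓ²` norm. Its positivity serves in place of Maschke's theorem and of unitarity. -/
theorem coeff_adj_mul_self (a : MonoidAlgebra ℂ G) :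
    (adj a * a).coeff 1 = ((∑ x, Complex.normSq (a.coeff x) : ℝ) : ℂ) := by
  rw [coeff_mul_eq_sum, Complex.ofReal_sum]
  refine Fintype.sum_equiv (Equiv.inv G) _ _ fun x => ?_
  simp [Complex.normSq_eq_conj_mul_self]

theorem coeff_adj_mul_self_ne_zero {a : MonoidAlgebra ℂ G} (ha : a ≠ 0) :
    (adj a * a).coeff 1 ≠ 0 := by
  rw [coeff_adj_mul_self]
  intro h
  rw [Complex.ofReal_eq_zero, Finset.sum_eq_zero_iff_of_nonneg fun _ _ => Complex.normSq_nonneg _]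
    at h
  exact ha (algebra_ext fun g => by simpa using h g (Finset.mem_univ g))

theorem adj_mul_self_ne_zero {a : MonoidAlgebra ℂ G} (ha : a ≠ 0) : adj a * a ≠ 0 := by
  intro h
  exact coeff_adj_mul_self_ne_zero ha (by simp [h])

/-- The operator `x ↦ a * x * b` of the group algebra. -/
def sandwich (a b : MonoidAlgebra ℂ G) : MonoidAlgebra ℂ G →ₗ[ℂ] MonoidAlgebra ℂ G :=
  (LinearMap.mulRight ℂ b).comp (LinearMap.mulLeft ℂ a)

/-- The basis of the group algebra given by the group elements. -/
def groupBasis (G : Type*) [Group G] : Module.Basis G ℂ (MonoidAlgebra ℂ G) :=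
  ⟨{ toFun := MonoidAlgebra.coeff
     invFun := MonoidAlgebra.ofCoeff
     map_add' := fun _ _ => rfl
     map_smul' := fun _ _ => rfl
     left_inv := fun _ => rfl
     right_inv := fun _ => rfl }⟩

instance : Module.Finite ℂ (MonoidAlgebra ℂ G) := .of_basis (groupBasis G)

/-- Computed in the basis of group elements; it yields the characters of the left ideals `ℂG ε`. -/
theorem trace_sandwich (a b : MonoidAlgebra ℂ G) :
    LinearMap.trace ℂ _ (sandwich a b) =
      ∑ x, (a * MonoidAlgebra.single x (1 : ℂ) * b).coeff x := by
  classical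
  rw [LinearMap.trace_eq_matrix_trace ℂ (groupBasis G), Matrix.trace]
  refine Finset.sum_congr rfl fun x _ => ?_
  rw [Matrix.diag_apply, LinearMap.toMatrix_apply]
  rfl

/-! ### The idempotent of a subgroup -/

open scoped Classical in
theorem coeff_idem (L : Subgroup G) (g : G) :
    (idem L).coeff g = if g ∈ L then (Nat.card L : ℂ)⁻¹ else 0 := by
  have := Fintype.ofFinite L
  rw [idem, finsum_eq_sum_of_fintype]
  simp only [MonoidAlgebra.coeff_smul, MonoidAlgebra.coeff_sum, MonoidAlgebra.coeff_single,
    Finsupp.smul_apply, Finsupp.finsetSum_apply, Finsupp.single_apply, smul_eq_mul]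
  split_ifs with h
  · rw [Finset.sum_eq_single ⟨g, h⟩]
    · simp
    · intro b _ hb
      rw [if_neg]
      exact fun h' => hb (Subtype.ext h')
    · simp
  · rw [Finset.sum_eq_zero, mul_zero]
    intro b _
    rw [if_neg]
    rintro rfl
    exact h b.2

theorem mul_idem_eq (L : Subgroup G) [Fintype L] (a : MonoidAlgebra ℂ G) :
    a * idem L = (Nat.card L : ℂ)⁻¹ • ∑ h : L, a * MonoidAlgebra.single (h : G) (1 : ℂ) := by
  rw [idem, finsum_eq_sum_of_fintype, mul_smul_comm, Finset.mul_sum]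

theorem coeff_mul_idem (L : Subgroup G) [Fintype L] (a : MonoidAlgebra ℂ G) (g : G) :
    (a * idem L).coeff g = (Nat.card L : ℂ)⁻¹ * ∑ h : L, a.coeff (g * (h : G)) := by
  rw [mul_idem_eq]
  simp only [MonoidAlgebra.coeff_smul, MonoidAlgebra.coeff_sum, Finsupp.smul_apply,
    Finsupp.finsetSum_apply, smul_eq_mul, MonoidAlgebra.coeff_mul_single_apply, mul_one]
  congr 1
  exact Fintype.sum_equiv (Equiv.inv L) _ _ fun x => by simp

theorem card_subgroup_ne_zero (L : Subgroup G) : (Nat.card L : ℂ) ≠ 0 :=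
  Nat.cast_ne_zero.2 Nat.card_pos.ne'

theorem adj_idem (L : Subgroup G) : adj (idem L) = idem L := by
  classical
  refine algebra_ext fun g => ?_
  rw [coeff_adj, coeff_idem, coeff_idem]
  by_cases h : g ∈ L <;> simp [h]

theorem mul_idem_of_invariant (L : Subgroup G) {a : MonoidAlgebra ℂ G}
    (h : ∀ g, ∀ l ∈ L, a.coeff (g * l) = a.coeff g) : a * idem L = a := by
  have := Fintype.ofFinite L
  refine algebra_ext fun g => ?_
  rw [coeff_mul_idem, Finset.sum_congr rfl fun (l : L) _ => h g l l.2, Finset.sum_const,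
    Finset.card_univ, nsmul_eq_mul, ← Nat.card_eq_fintype_card,
    inv_mul_cancel_left₀ (card_subgroup_ne_zero L)]

theorem coeff_idem_mul_right (L : Subgroup G) (g : G) {l : G} (hl : l ∈ L) :
    (idem L).coeff (g * l) = (idem L).coeff g := by
  classical
  rw [coeff_idem, coeff_idem, if_congr (L.mul_mem_cancel_right hl) rfl rfl]

theorem idem_mul_idem (L : Subgroup G) : idem L * idem L = idem L :=
  mul_idem_of_invariant L fun g _ hl => coeff_idem_mul_right L g hl

theorem coeff_mul_right_of_mul_idem {L : Subgroup G} {a : MonoidAlgebra ℂ G}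
    (ha : a * idem L = a) (g : G) {l : G} (hl : l ∈ L) : a.coeff (g * l) = a.coeff g := by
  rw [← ha, coeff_mul_eq_sum, coeff_mul_eq_sum]
  refine Finset.sum_congr rfl fun x _ => ?_
  rw [← mul_assoc, coeff_idem_mul_right L _ hl]

theorem coeff_mul_left_of_idem_mul {L : Subgroup G} {a : MonoidAlgebra ℂ G}
    (ha : idem L * a = a) (g : G) {l : G} (hl : l ∈ L) : a.coeff (l * g) = a.coeff g := by
  have h : adj a * idem L = adj a := by
    nth_rw 2 [← ha]
    rw [adj_mul, adj_idem]
  have := coeff_mul_right_of_mul_idem h g⁻¹ (L.inv_mem hl)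
  rw [coeff_adj, coeff_adj, ← mul_inv_rev, inv_inv, inv_inv] at this
  exact (starRingEnd ℂ).injective this

end GroupAlgebra

/-! ### Primitive idempotents of a commutative Hecke algebra -/

section HeckeSystem

variable {G : Type*} [Group G] [Fintype G] {ι : Type*} [Fintype ι]

/-- `ε` is a complete system of orthogonal primitive idempotents of `e_L ℂG e_L`, such that the
left ideals `ℂG (ε i)` are absolutely simple and pairwise nonisomorphic. -/
structure IsHeckeSystem (L : Subgroup G) (ε : ι → MonoidAlgebra ℂ G) : Prop where
  ne_zero : ∀ i, ε i ≠ 0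
  sum_eq : ∑ i, ε i = idem L
  mul_self : ∀ i, ε i * ε i = ε i
  cross : ∀ i j a, i ≠ j → ε i * a * ε j = 0
  corner : ∀ i a, ∃ c : ℂ, ε i * a * ε i = c • ε i

namespace IsHeckeSystem

variable {L : Subgroup G} {ε : ι → MonoidAlgebra ℂ G} (h : IsHeckeSystem L ε)

include h

theorem mul_of_ne {i j : ι} (hij : i ≠ j) : ε i * ε j = 0 := by
  simpa using h.cross i j 1 hij

theorem mul_idem (i : ι) : ε i * idem L = ε i := by
  rw [← h.sum_eq, Finset.mul_sum,
    Finset.sum_eq_single i (fun j _ hj => h.mul_of_ne hj.symm) (by simp), h.mul_self]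

/-- Inserting `e_L = ∑ ε_j` on the left of `ε* ε` leaves only `ε ε* ε = c ε`. Taking adjoints shows
that `ε*` is a multiple of `ε`, and two nonzero proportional idempotents coincide. -/
theorem adj_eq (i : ι) : adj (ε i) = ε i := by
  have h1 : idem L * adj (ε i) = adj (ε i) := by
    nth_rw 2 [← h.mul_idem i]
    rw [adj_mul, adj_idem]
  obtain ⟨c, hc⟩ := h.corner i (adj (ε i))
  have h2 : adj (ε i) * ε i = c • ε i := by
    rw [← hc]
    nth_rw 1 [← h1]
    rw [← h.sum_eq, Finset.sum_mul, Finset.sum_mul,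
      Finset.sum_eq_single i (fun j _ hj => h.cross j i _ hj) (by simp)]
  have h3 : adj (ε i) * ε i = starRingEnd ℂ c • adj (ε i) := by
    rw [← adj_smul, ← h2, adj_mul, adj_adj]
  have hc0 : c ≠ 0 := by
    rintro rfl
    exact adj_mul_self_ne_zero (h.ne_zero i) (by rw [h2, zero_smul])
  have h4 : adj (ε i) = ((starRingEnd ℂ c)⁻¹ * c) • ε i := by
    rw [mul_smul, ← h2, h3, smul_smul, inv_mul_cancel₀, one_smul]
    simpa using hc0
  set t := (starRingEnd ℂ c)⁻¹ * c
  have ht : t ≠ 0 := mul_ne_zero (inv_ne_zero (by simpa using hc0)) hc0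
  have h5 : adj (ε i) * adj (ε i) = adj (ε i) := by rw [← adj_mul, h.mul_self]
  rw [h4, smul_mul_smul_comm, h.mul_self] at h5
  have h6 : t * t = t := smul_left_injective ℂ (h.ne_zero i) h5
  rw [h4, mul_right_cancel₀ ht (h6.trans (one_mul t).symm), one_smul]

theorem coeff_inv (i : ι) (g : G) : (ε i).coeff g⁻¹ = starRingEnd ℂ ((ε i).coeff g) := by
  conv_lhs => rw [← h.adj_eq i]
  rw [coeff_adj, inv_inv]

theorem coeff_one_ne_zero (i : ι) : (ε i).coeff 1 ≠ 0 := by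
  have := coeff_adj_mul_self_ne_zero (h.ne_zero i)
  rwa [h.adj_eq, h.mul_self] at this

theorem conj_coeff_one (i : ι) : starRingEnd ℂ ((ε i).coeff 1) = (ε i).coeff 1 := by
  rw [← h.coeff_inv, inv_one]

/-- The scalar is found by comparing coefficients at `1`, a functional that is invariant under
cyclic permutation of products. -/
theorem corner_eq (i : ι) (a : MonoidAlgebra ℂ G) :
    ε i * a * ε i = ((a * ε i).coeff 1 / (ε i).coeff 1) • ε i := by
  obtain ⟨c, hc⟩ := h.corner i a
  have h1 := congrArg (fun b => b.coeff 1) hc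
  simp only [MonoidAlgebra.coeff_smul, Finsupp.smul_apply, smul_eq_mul] at h1
  rw [mul_assoc, coeff_mul_one_comm, mul_assoc, h.mul_self] at h1
  rw [hc, h1, mul_div_cancel_right₀ _ (h.coeff_one_ne_zero i)]

theorem corner_single (i : ι) (g : G) :
    ε i * MonoidAlgebra.single g (1 : ℂ) * ε i =
      (starRingEnd ℂ ((ε i).coeff g) / (ε i).coeff 1) • ε i := by
  rw [h.corner_eq, MonoidAlgebra.coeff_single_mul_apply, one_mul, mul_one, h.coeff_inv]

theorem idem_mul_mul_idem (a : MonoidAlgebra ℂ G) :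
    idem L * a * idem L = ∑ i, ε i * a * ε i := by
  rw [← h.sum_eq, Finset.sum_mul, Finset.sum_mul]
  refine Finset.sum_congr rfl fun i _ => ?_
  rw [Finset.mul_sum,
    Finset.sum_eq_single i (fun j _ hj => h.cross i j a hj.symm) (by simp)]

theorem idem_mul_single_mul_idem (g : G) :
    idem L * MonoidAlgebra.single g (1 : ℂ) * idem L =
      ∑ i, (starRingEnd ℂ ((ε i).coeff g) / (ε i).coeff 1) • ε i := by
  rw [h.idem_mul_mul_idem]
  exact Finset.sum_congr rfl fun i _ => h.corner_single i g

theorem isGelfandPair : IsGelfandPair L := by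
  intro a b
  have key : ∀ a b : MonoidAlgebra ℂ G, (idem L * a * idem L) * (idem L * b * idem L) =
      ∑ i, ((a * ε i).coeff 1 / (ε i).coeff 1 * ((b * ε i).coeff 1 / (ε i).coeff 1)) • ε i := by
    intro a b
    rw [h.idem_mul_mul_idem, h.idem_mul_mul_idem, Finset.sum_mul]
    refine Finset.sum_congr rfl fun i _ => ?_
    rw [Finset.mul_sum, Finset.sum_eq_single i, h.corner_eq, h.corner_eq, smul_mul_smul_comm,
      h.mul_self]
    · intro j _ hj
      rw [h.corner_eq, h.corner_eq, smul_mul_smul_comm, h.mul_of_ne hj.symm, smul_zero]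
    · simp
  rw [key, key]
  simp only [mul_comm]

/-- Multiplication by `ε i` is the identity on `ℂG (ε i)`. -/
theorem mul_eq_of_mem {i : ι} {a : MonoidAlgebra ℂ G} (ha : a ∈ Ideal.span {ε i}) :
    a * ε i = a := by
  obtain ⟨b, rfl⟩ := Ideal.mem_span_singleton'.1 ha
  rw [mul_assoc, h.mul_self]

theorem isIrredDecomp : IsIrredDecomp L fun i => Ideal.span {ε i} where
  simple i := by
    rw [isSimpleModule_iff_isAtom]
    refine ⟨fun h0 => h.ne_zero i (Ideal.span_singleton_eq_bot.1 h0), fun N hN => ?_⟩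
    by_contra hN0
    obtain ⟨a, haN, ha0⟩ := Submodule.exists_mem_ne_zero_of_ne_bot hN0
    have ha : a * ε i = a := h.mul_eq_of_mem (hN.le haN)
    have h1 : ε i * adj a = adj a := by
      nth_rw 2 [← ha]
      rw [adj_mul, h.adj_eq]
    -- For `a ≠ 0` in the submodule, `a* a = ε a* a ε` is a nonzero multiple of `ε`, so the
    -- submodule contains the generator.
    obtain ⟨c, hc⟩ := h.corner i (adj a * a)
    rw [← mul_assoc, h1, mul_assoc, ha] at hc
    have hc0 : c ≠ 0 := by
      rintro rfl
      exact adj_mul_self_ne_zero ha0 (by rw [hc, zero_smul])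
    refine hN.not_ge ?_
    rw [Ideal.span_singleton_le_iff_mem]
    have h2 : ε i = (c⁻¹ • adj a) * a := by
      rw [smul_mul_assoc, hc, smul_smul, inv_mul_cancel₀ hc0, one_smul]
    rw [h2]
    exact N.smul_mem _ haN
  indep := by
    classical
    rw [iSupIndep_iff_finsetSum_eq_zero_imp_eq_zero]
    intro s v hv hs i hi
    have h1 := congrArg (fun b => b * ε i) hs
    simp only [Finset.sum_mul, zero_mul] at h1
    rw [Finset.sum_eq_single i] at h1
    · rwa [h.mul_eq_of_mem (hv i hi)] at h1
    · intro j hj hji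
      rw [← h.mul_eq_of_mem (hv j hj), mul_assoc, h.mul_of_ne hji, mul_zero]
    · exact fun h' => absurd hi h'
  iSup_eq := by
    refine le_antisymm (iSup_le fun i => ?_) ?_
    · rw [permModule, Ideal.span_singleton_le_iff_mem, Ideal.mem_span_singleton']
      exact ⟨ε i, h.mul_idem i⟩
    · rw [permModule, Ideal.span_singleton_le_iff_mem, ← h.sum_eq]
      exact Submodule.sum_mem _ fun i _ =>
        Submodule.mem_iSup_of_mem i (Ideal.mem_span_singleton_self _)

/-- The operator `x ↦ g x ε` maps the whole group algebra into `ℂG ε` and agrees there with the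
action of `g`, so both have the same trace. -/
theorem character_eq (i : ι) (g : G) :
    character (Ideal.span {ε i}) g = ∑ x, (ε i).coeff (x⁻¹ * (g⁻¹ * x)) := by
  have h1 : ∀ x, sandwich (MonoidAlgebra.single g 1) (ε i) x ∈
      (Ideal.span {ε i}).restrictScalars ℂ := fun x =>
    Ideal.mem_span_singleton'.2 ⟨_, rfl⟩
  have h2 := LinearMap.trace_restrict_eq_of_forall_mem _ _ h1
  rw [trace_sandwich] at h2
  calc character (Ideal.span {ε i}) g
      = LinearMap.trace ℂ _ ((sandwich (MonoidAlgebra.single g 1) (ε i)).restrict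
          fun x _ => h1 x) := by
        rw [character]
        congr 1
        refine LinearMap.ext fun x => Subtype.ext ?_
        change MonoidAlgebra.single g 1 * (x : MonoidAlgebra ℂ G) =
          MonoidAlgebra.single g 1 * (x : MonoidAlgebra ℂ G) * ε i
        rw [mul_assoc, h.mul_eq_of_mem x.2]
    _ = _ := by
        rw [h2]
        refine Finset.sum_congr rfl fun x _ => ?_
        rw [MonoidAlgebra.single_mul_single, MonoidAlgebra.coeff_single_mul_apply]
        simp [mul_assoc]

theorem finrank_eq (i : ι) :
    (Module.finrank ℂ (Ideal.span {ε i}) : ℂ) = Nat.card G * (ε i).coeff 1 := by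
  have h1 := h.character_eq i 1
  rw [character, ← MonoidAlgebra.one_def, map_one, LinearMap.trace_one] at h1
  rw [h1]
  simp [Nat.card_eq_fintype_card]

/-- The central element `∑ x, x ε x⁻¹` acts on `ℂG ε` as the scalar `1 / ε(1)`. -/
theorem sum_conj_mul (i : ι) :
    ofFun (fun g => ∑ x, (ε i).coeff (x⁻¹ * (g * x))) * idem L =
      ((ε i).coeff 1)⁻¹ • ε i := by
  set z := ofFun (fun g => ∑ x, (ε i).coeff (x⁻¹ * (g * x)))
  have hz : z = ∑ x, MonoidAlgebra.single x 1 * ε i * MonoidAlgebra.single x⁻¹ 1 := by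
    refine algebra_ext fun g => ?_
    simp only [z, coeff_ofFun, MonoidAlgebra.coeff_sum, Finsupp.finsetSum_apply]
    refine Finset.sum_congr rfl fun x _ => ?_
    rw [MonoidAlgebra.coeff_mul_single_apply, MonoidAlgebra.coeff_single_mul_apply]
    simp
  have hcomm : ε i * z = z * ε i := by
    refine algebra_ext fun g => ?_
    rw [coeff_mul_eq_sum, coeff_mul_eq_sum]
    refine Fintype.sum_equiv ((Equiv.inv G).trans (Equiv.mulLeft g)) _ _ fun x => ?_
    simp only [z, coeff_ofFun, Equiv.trans_apply, Equiv.inv_apply, Equiv.coe_mulLeft,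
      mul_inv_rev, inv_inv, inv_mul_cancel_right]
    rw [mul_comm]
    congr 1
    refine Fintype.sum_equiv (Equiv.mulLeft x) _ _ fun y => ?_
    simp [mul_assoc]
  -- Each summand of `z * ε j` contains a factor `ε i * x⁻¹ * ε j`, which vanishes for `j ≠ i`.
  have h1 : z * idem L = z * ε i := by
    rw [← h.sum_eq, Finset.mul_sum, Finset.sum_eq_single i _ (by simp)]
    intro j _ hj
    rw [hz, Finset.sum_mul]
    refine Finset.sum_eq_zero fun x _ => ?_
    rw [mul_assoc, mul_assoc, ← mul_assoc (ε i), h.cross i j _ hj.symm, mul_zero]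
  have h2 : z * ε i = ε i * z * ε i := by
    rw [hcomm, mul_assoc, h.mul_self]
  -- The Schur relation `∑ |ε(x)|² = ε(1)`, read off from `ε ε ε = ε` by expanding the middle
  -- factor.
  have h3 : ∑ x, starRingEnd ℂ ((ε i).coeff x) / (ε i).coeff 1 * (ε i).coeff x = 1 := by
    have h4 : ε i * (∑ x, (ε i).coeff x • MonoidAlgebra.single x (1 : ℂ)) * ε i =
        (∑ x, starRingEnd ℂ ((ε i).coeff x) / (ε i).coeff 1 * (ε i).coeff x) • ε i := by
      rw [Finset.mul_sum, Finset.sum_mul, Finset.sum_smul]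
      refine Finset.sum_congr rfl fun x _ => ?_
      rw [mul_smul_comm, smul_mul_assoc, h.corner_single, smul_smul, mul_comm]
    rw [← eq_sum_single, h.mul_self, h.mul_self] at h4
    exact smul_left_injective ℂ (h.ne_zero i) (h4.symm.trans (one_smul _ _).symm)
  rw [h1, h2, hz, Finset.mul_sum, Finset.sum_mul]
  calc _ = ∑ x, (((ε i).coeff 1)⁻¹ *
        (starRingEnd ℂ ((ε i).coeff x) / (ε i).coeff 1 * (ε i).coeff x)) • ε i := by
        refine Finset.sum_congr rfl fun x _ => ?_
        rw [← mul_assoc, ← mul_assoc, h.corner_single, smul_mul_assoc, smul_mul_assoc,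
          h.corner_single, smul_smul, h.coeff_inv, Complex.conj_conj]
        congr 1
        ring
    _ = _ := by rw [← Finset.sum_smul, ← Finset.mul_sum, h3, mul_one]

/-- The conjugate character is the coefficient function of the central element in `sum_conj_mul`;
averaging it over `L` is right multiplication by `e_L`. -/
theorem zonal_eq (i : ι) (g : G) :
    zonal L (Ideal.span {ε i}) g = (ε i).coeff g / (ε i).coeff 1 := by
  have := Fintype.ofFinite L
  have h1 := congrArg (fun b => b.coeff g) (h.sum_conj_mul i)
  simp only [coeff_mul_idem, MonoidAlgebra.coeff_smul, Finsupp.smul_apply, smul_eq_mul,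
    coeff_ofFun] at h1
  rw [div_eq_inv_mul, ← h1, zonal, finsum_eq_sum_of_fintype]
  congr 1
  refine Finset.sum_congr rfl fun l _ => ?_
  rw [h.character_eq, map_sum]
  refine Finset.sum_congr rfl fun x _ => ?_
  rw [← h.coeff_inv]
  simp [mul_assoc]

theorem coeff_eq (i : ι) (g : G) :
    (ε i).coeff g = (ε i).coeff 1 * zonal L (Ideal.span {ε i}) g := by
  rw [h.zonal_eq, mul_div_cancel₀ _ (h.coeff_one_ne_zero i)]

omit h in
/-- A complete orthogonal system of nonzero idempotents spanning `e_L ℂG e_L`. -/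
theorem of_span (h0 : ∀ i, ε i ≠ 0) (hs : ∑ i, ε i = idem L) (h1 : ∀ i, ε i * ε i = ε i)
    (h2 : ∀ i j, i ≠ j → ε i * ε j = 0)
    (h3 : ∀ a, ∃ c : ι → ℂ, idem L * a * idem L = ∑ i, c i • ε i) : IsHeckeSystem L ε := by
  have hl : ∀ i, ε i * idem L = ε i := fun i => by
    rw [← hs, Finset.mul_sum,
      Finset.sum_eq_single i (fun j _ hj => h2 _ _ hj.symm) (by simp), h1]
  have hr : ∀ i, idem L * ε i = ε i := fun i => by
    rw [← hs, Finset.sum_mul,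
      Finset.sum_eq_single i (fun j _ hj => h2 _ _ hj) (by simp), h1]
  have key : ∀ i j a, ∃ c : ℂ, ε i * a * ε j = c • (ε i * ε j) := fun i j a => by
    obtain ⟨c, hc⟩ := h3 a
    refine ⟨c i, ?_⟩
    calc ε i * a * ε j = ε i * (idem L * a * idem L) * ε j := by
          nth_rw 1 [← hl i, ← hr j]
          simp only [mul_assoc]
      _ = _ := by
          rw [hc, Finset.mul_sum, Finset.sum_eq_single i, mul_smul_comm, h1, smul_mul_assoc]
          · intro k _ hk
            rw [mul_smul_comm, h2 _ _ hk.symm, smul_zero]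
          · simp
  refine ⟨h0, hs, h1, fun i j a hij => ?_, fun i a => ?_⟩
  · obtain ⟨c, hc⟩ := key i j a
    rw [hc, h2 i j hij, smul_zero]
  · obtain ⟨c, hc⟩ := key i i a
    exact ⟨c, by rw [hc, h1]⟩

end IsHeckeSystem

/-- The idempotents attached to a decomposition of the permutation module of a Gelfand pair. -/
theorem IsIrredDecomp.exists_heckeSystem {L : Subgroup G} (hL : IsGelfandPair L)
    {V : ι → Ideal (MonoidAlgebra ℂ G)} (hV : IsIrredDecomp L V) :
    ∃ ε : ι → MonoidAlgebra ℂ G, IsHeckeSystem L ε ∧ ∀ i, V i = Ideal.span {ε i} := by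
  classical
  have he : idem L ∈ ⨆ i, V i := by
    rw [hV.iSup_eq]
    exact Ideal.mem_span_singleton_self _
  rw [Submodule.mem_iSup_iff_exists_dfinsupp] at he
  obtain ⟨f, hf⟩ := he
  obtain ⟨ε, hmem, hsum⟩ : ∃ ε : ι → MonoidAlgebra ℂ G, (∀ i, ε i ∈ V i) ∧
      ∑ i, ε i = idem L := by
    refine ⟨fun i => f i, fun i => (f i).2, ?_⟩
    rw [← hf, DFinsupp.lsum_apply_apply, DFinsupp.sumAddHom_apply, DFinsupp.sum_eq_sum_fintype]
    · rfl
    · simp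
  have hindep := (iSupIndep_iff_finsetSum_eq_imp_eq V).1 hV.indep
  have hle : ∀ i, V i ≤ permModule L := fun i => hV.iSup_eq ▸ le_iSup V i
  have hright : ∀ i, ∀ v ∈ V i, v * idem L = v := fun i v hv => by
    obtain ⟨b, rfl⟩ := Ideal.mem_span_singleton'.1 (hle i hv)
    rw [mul_assoc, idem_mul_idem]
  -- Both families decompose `v = v * e_L` along the `V j`, so independence forces them to agree.
  have hproj : ∀ i, ∀ v ∈ V i, ∀ j, v * ε j = if j = i then v else 0 := by
    intro i v hv j
    refine hindep Finset.univ (fun j => v * ε j) (fun j => if j = i then v else 0)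
      (fun j _ => ⟨(V j).mul_mem_left _ (hmem j), ?_⟩) ?_ j (Finset.mem_univ j)
    · split_ifs with hj
      · exact hj ▸ hv
      · exact (V j).zero_mem
    · rw [← Finset.mul_sum, hsum, hright i v hv]
      simp
  have hspan : ∀ i, V i = Ideal.span {ε i} := fun i => by
    refine le_antisymm (fun v hv => ?_) ?_
    · exact Ideal.mem_span_singleton'.2 ⟨v, by simpa using hproj i v hv i⟩
    · rw [Ideal.span_singleton_le_iff_mem]
      exact hmem i
  have hself : ∀ i, ε i * ε i = ε i := fun i => by simpa using hproj i _ (hmem i) i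
  have hne : ∀ i j, i ≠ j → ε i * ε j = 0 := fun i j hij => by
    simpa [hij.symm] using hproj i _ (hmem i) j
  have hleft : ∀ i, idem L * ε i = ε i := fun i => by
    rw [← hsum, Finset.sum_mul,
      Finset.sum_eq_single i (fun j _ hj => hne _ _ hj) (by simp), hself]
  refine ⟨ε, ⟨fun i h0 => ?_, hsum, hself, fun i j a hij => ?_, fun i a => ?_⟩, hspan⟩
  · have := hV.simple i
    have hb : V i = ⊥ := by rw [hspan i, h0, Ideal.span_singleton_eq_bot]
    exact ((isSimpleModule_iff_isAtom).1 this).1 hb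
  · have h1 := hL (ε i) (a * ε j)
    rw [hleft, hright i _ (hmem i), mul_assoc (idem L) (a * ε j), mul_assoc a,
      hright j _ (hmem j)] at h1
    calc ε i * a * ε j = ε i * idem L * (a * ε j) := by
          rw [hright i _ (hmem i), mul_assoc]
      _ = ε i * (idem L * (a * ε j)) := mul_assoc _ _ _
      _ = _ := by rw [h1, mul_assoc, mul_assoc, hne j i hij.symm, mul_zero, mul_zero]
  · have := hV.simple i
    -- Right multiplication by `a * ε i` commutes with the left action, so Schur's lemma makes it a
    -- scalar; evaluating at `ε i` gives the corner relation.
    let φ : Module.End (MonoidAlgebra ℂ G) (V i) :=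
      { toFun := fun x => ⟨x * (a * ε i), by
          rw [← mul_assoc]; exact (V i).mul_mem_left _ (hmem i)⟩
        map_add' := fun x y => Subtype.ext (add_mul _ _ _)
        map_smul' := fun r x => Subtype.ext (mul_assoc _ _ _) }
    have : FiniteDimensional ℂ (V i) :=
      inferInstanceAs (FiniteDimensional ℂ ((V i).restrictScalars ℂ))
    obtain ⟨c, hc⟩ := (IsSimpleModule.algebraMap_end_bijective_of_isAlgClosed
      (A := MonoidAlgebra ℂ G) (V := V i) ℂ).2 φ
    refine ⟨c, ?_⟩
    have h1 := congrArg Subtype.val (LinearMap.congr_fun hc ⟨ε i, hmem i⟩)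
    rw [mul_assoc]
    exact h1.symm

end HeckeSystem

/-! ### Words and their types -/

section Words

variable {s n : ℕ}

/-- The type of a word `i` in the letters `Fin s`: the number of occurrences of each letter. -/
def wordType (i : Fin n → Fin s) : Comp s n :=
  ⟨fun a => (Finset.univ.filter fun j => i j = a).card, by
    rw [Finset.mem_piAntidiag]
    refine ⟨?_, by simp⟩
    rw [← Finset.card_eq_sum_card_fiberwise (fun _ _ => Finset.mem_univ _)]
    simp⟩

theorem wordType_comp_perm (i : Fin n → Fin s) (σ : Equiv.Perm (Fin n)) :
    wordType (i ∘ σ) = wordType i := by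
  refine Subtype.ext (funext fun a => ?_)
  change (Finset.univ.filter fun j => i (σ j) = a).card =
    (Finset.univ.filter fun j => i j = a).card
  exact Finset.card_equiv σ (by simp)

theorem exists_perm_of_wordType_eq {i i' : Fin n → Fin s} (h : wordType i = wordType i') :
    ∃ σ : Equiv.Perm (Fin n), i' ∘ σ = i := by
  have hc : ∀ a, Nonempty ({j // i j = a} ≃ {j // i' j = a}) := fun a => by
    rw [← Fintype.card_eq, Fintype.card_subtype, Fintype.card_subtype]
    exact congrFun (congrArg Subtype.val h) a
  exact ⟨Equiv.ofFiberEquiv fun a => (hc a).some,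
    funext fun j => Equiv.ofFiberEquiv_map (fun a => (hc a).some) j⟩

theorem prod_word {M : Type*} [CommMonoid M] (w : Fin s → M) (i : Fin n → Fin s) :
    ∏ j, w (i j) = ∏ a, w a ^ (wordType i).1 a := by
  rw [← Finset.prod_fiberwise' Finset.univ i w]
  simp [wordType]

theorem sum_word {M : Type*} [AddCommMonoid M] (w : Fin s → M) (i : Fin n → Fin s) :
    ∑ j, w (i j) = ∑ a, (wordType i).1 a • w a := by
  rw [← Finset.sum_fiberwise' Finset.univ i w]
  simp [wordType]

/-- Expanding the product chooses one letter per factor, and the resulting monomial records only the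
type of the word. -/
theorem coeff_prod_linear (w : Fin n → Fin s → ℂ) (k : Comp s n) :
    (∏ j, ∑ a, MvPolynomial.C (w j a) * MvPolynomial.X a : MvPolynomial (Fin s) ℂ).coeff
        (Finsupp.equivFunOnFinite.symm k.1) =
      ∑ i : Fin n → Fin s with wordType i = k, ∏ j, w j (i j) := by
  rw [Finset.prod_univ_sum, Fintype.piFinset_univ, MvPolynomial.coeff_sum, Finset.sum_filter]
  refine Finset.sum_congr rfl fun i _ => ?_
  have h1 : (∏ j, MvPolynomial.C (w j (i j)) * MvPolynomial.X (i j) : MvPolynomial (Fin s) ℂ) =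
      MvPolynomial.monomial (Finsupp.equivFunOnFinite.symm (wordType i).1) (∏ j, w j (i j)) := by
    rw [Finset.prod_mul_distrib, prod_word, MvPolynomial.monomial_eq, map_prod,
      Finsupp.prod_fintype _ _ (by simp)]
    rfl
  rw [h1, MvPolynomial.coeff_monomial]
  refine if_congr ?_ rfl rfl
  rw [Finsupp.equivFunOnFinite.symm.injective.eq_iff, Subtype.ext_iff]

/-- Two expansions of `(∑ X_a)^n` are compared: over words, and by the multinomial theorem. -/
theorem card_wordType_eq (k : Comp s n) :
    (Finset.univ.filter fun i : Fin n → Fin s => wordType i = k).card = multinom k := by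
  have h1 := coeff_prod_linear (fun _ _ => (1 : ℂ)) k
  simp only [map_one, one_mul, Finset.prod_const_one, Finset.prod_const, Finset.card_univ,
    Fintype.card_fin, Finset.sum_const, nsmul_eq_mul, mul_one] at h1
  have h2 : ∀ l : Fin s → ℕ, (∏ a, (MvPolynomial.X a : MvPolynomial (Fin s) ℂ) ^ l a) =
      MvPolynomial.monomial (Finsupp.equivFunOnFinite.symm l) 1 := fun l => by
    rw [MvPolynomial.monomial_eq, Finsupp.prod_fintype _ _ (by simp), map_one, one_mul]
    rfl
  rw [Finset.sum_pow_eq_sum_piAntidiag, MvPolynomial.coeff_sum, Finset.sum_eq_single k.1] at h1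
  · rw [h2, ← map_natCast MvPolynomial.C, MvPolynomial.coeff_C_mul,
      MvPolynomial.coeff_monomial, if_pos rfl, mul_one] at h1
    exact_mod_cast h1.symm
  · intro l _ hl
    rw [h2, ← map_natCast MvPolynomial.C, MvPolynomial.coeff_C_mul,
      MvPolynomial.coeff_monomial, if_neg, mul_zero]
    exact fun h => hl (Finsupp.equivFunOnFinite.symm.injective h)
  · exact fun h => absurd k.2 h

theorem multinom_ne_zero (k : Comp s n) : (multinom k : ℂ) ≠ 0 :=
  Nat.cast_ne_zero.2 (Nat.multinomial_pos _ _).ne'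

theorem wordType_surjective : Function.Surjective (wordType : (Fin n → Fin s) → Comp s n) := by
  intro k
  have h : (Finset.univ.filter fun i : Fin n → Fin s => wordType i = k).Nonempty := by
    rw [← Finset.card_pos, card_wordType_eq]
    exact Nat.multinomial_pos _ _
  obtain ⟨i, hi⟩ := h
  exact ⟨i, (Finset.mem_filter.1 hi).2⟩

end Words

/-! ### Pure tensors in the group algebra of `K^n` -/

section Tensor

variable {K : Type*} [Group K] [Fintype K] {n : ℕ}

/-- The pure tensor `f_1 ⊗ ⋯ ⊗ f_n`, as an element of the group algebra of `K^n`. -/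
def tensor (f : Fin n → MonoidAlgebra ℂ K) : MonoidAlgebra ℂ (Fin n → K) :=
  ofFun fun x => ∏ j, (f j).coeff (x j)

@[simp]
theorem coeff_tensor (f : Fin n → MonoidAlgebra ℂ K) (x : Fin n → K) :
    (tensor f).coeff x = ∏ j, (f j).coeff (x j) := rfl

theorem tensor_mul (f g : Fin n → MonoidAlgebra ℂ K) :
    tensor f * tensor g = tensor fun j => f j * g j := by
  refine algebra_ext fun y => ?_
  simp only [coeff_mul_eq_sum, coeff_tensor]
  rw [Finset.prod_univ_sum, Fintype.piFinset_univ]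
  exact Finset.sum_congr rfl fun x _ => Finset.prod_mul_distrib.symm

theorem tensor_sum {s : ℕ} (f : Fin n → Fin s → MonoidAlgebra ℂ K) :
    (tensor fun j => ∑ a, f j a) = ∑ i : Fin n → Fin s, tensor fun j => f j (i j) := by
  refine algebra_ext fun y => ?_
  simp only [coeff_tensor, MonoidAlgebra.coeff_sum, Finsupp.finsetSum_apply]
  rw [Finset.prod_univ_sum, Fintype.piFinset_univ]

theorem tensor_smul (c : Fin n → ℂ) (f : Fin n → MonoidAlgebra ℂ K) :
    (tensor fun j => c j • f j) = (∏ j, c j) • tensor f :=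
  algebra_ext fun y => by simp [Finset.prod_mul_distrib]

theorem tensor_single (x : Fin n → K) :
    (tensor fun j => MonoidAlgebra.single (x j) (1 : ℂ)) = MonoidAlgebra.single x 1 := by
  classical
  refine algebra_ext fun y => ?_
  simp only [coeff_tensor, MonoidAlgebra.coeff_single, Finsupp.single_apply]
  rw [Finset.prod_ite_zero]
  simp [funext_iff]

theorem IsHeckeSystem.tensor_mul_tensor {s : ℕ} {L : Subgroup K}
    {ε : Fin s → MonoidAlgebra ℂ K} (h : IsHeckeSystem L ε) (i i' : Fin n → Fin s) :
    (tensor fun j => ε (i j)) * (tensor fun j => ε (i' j)) =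
      if i = i' then tensor fun j => ε (i j) else 0 := by
  rw [tensor_mul]
  split_ifs with hi
  · subst hi
    simp only [h.mul_self]
  · obtain ⟨j, hj⟩ := Function.ne_iff.1 hi
    refine algebra_ext fun y => ?_
    rw [coeff_tensor]
    exact Finset.prod_eq_zero (Finset.mem_univ j) (by rw [h.mul_of_ne hj]; rfl)

/-- Invariance under permutations of the coordinates. -/
def IsSymm (F : MonoidAlgebra ℂ (Fin n → K)) : Prop :=
  ∀ (σ : Equiv.Perm (Fin n)) (x : Fin n → K), F.coeff (x ∘ σ) = F.coeff x

theorem isSymm_tensor_const (a : MonoidAlgebra ℂ K) : IsSymm (n := n) (tensor fun _ => a) :=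
  fun σ x => Equiv.prod_comp σ fun j => a.coeff (x j)

/-- The sum of the pure tensors `ε_{i_1} ⊗ ⋯ ⊗ ε_{i_n}` over the words `i` of type `k`. -/
def symTensor {s : ℕ} (ε : Fin s → MonoidAlgebra ℂ K) (k : Comp s n) :
    MonoidAlgebra ℂ (Fin n → K) :=
  ∑ i : Fin n → Fin s with wordType i = k, tensor fun j => ε (i j)

theorem coeff_symTensor {s : ℕ} (ε : Fin s → MonoidAlgebra ℂ K) (k : Comp s n) (x : Fin n → K) :
    (symTensor ε k).coeff x =
      ∑ i : Fin n → Fin s with wordType i = k, ∏ j, (ε (i j)).coeff (x j) := by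
  simp [symTensor, MonoidAlgebra.coeff_sum, Finsupp.finsetSum_apply]

theorem isSymm_symTensor {s : ℕ} (ε : Fin s → MonoidAlgebra ℂ K) (k : Comp s n) :
    IsSymm (symTensor ε k) := by
  intro σ x
  rw [coeff_symTensor, coeff_symTensor]
  refine Finset.sum_equiv (σ.arrowCongr (Equiv.refl _)) (fun i => ?_) fun i _ => ?_
  · simp only [Finset.mem_filter, Finset.mem_univ, true_and]
    rw [← wordType_comp_perm i σ.symm]
    rfl
  · exact Fintype.prod_equiv σ _ _ fun j => by simp

theorem sum_symTensor {s : ℕ} (ε : Fin s → MonoidAlgebra ℂ K) :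
    ∑ k : Comp s n, symTensor ε k = tensor fun _ => ∑ a, ε a := by
  rw [tensor_sum]
  exact Finset.sum_fiberwise Finset.univ wordType _

theorem sum_smul_symTensor {s : ℕ} (ε : Fin s → MonoidAlgebra ℂ K) (c : Comp s n → ℂ) :
    ∑ k : Comp s n, c k • symTensor ε k =
      ∑ i : Fin n → Fin s, c (wordType i) • tensor fun j => ε (i j) := by
  rw [← Finset.sum_fiberwise Finset.univ wordType]
  refine Finset.sum_congr rfl fun k _ => ?_
  rw [symTensor, Finset.smul_sum]
  refine Finset.sum_congr rfl fun i hi => ?_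
  rw [(Finset.mem_filter.1 hi).2]

theorem IsHeckeSystem.symTensor_mul_symTensor {s : ℕ} {L : Subgroup K}
    {ε : Fin s → MonoidAlgebra ℂ K} (h : IsHeckeSystem L ε) (k l : Comp s n) :
    symTensor ε k * symTensor ε l = if k = l then symTensor ε k else 0 := by
  rw [symTensor, symTensor, Finset.sum_mul]
  simp only [Finset.mul_sum, h.tensor_mul_tensor, Finset.sum_ite_eq]
  split_ifs with hkl
  · subst hkl
    exact Finset.sum_congr rfl fun i hi => if_pos hi
  · refine Finset.sum_eq_zero fun i hi => if_neg fun hi' => hkl ?_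
    rw [← (Finset.mem_filter.1 hi).2, ← (Finset.mem_filter.1 hi').2]

/-- A bi-invariant element of the group algebra of `K^n` is a combination of the pure tensors in
the idempotents; a symmetric one is a combination of the symmetrized ones. -/
theorem IsHeckeSystem.exists_eq_sum_symTensor {s : ℕ} {L : Subgroup K}
    {ε : Fin s → MonoidAlgebra ℂ K} (h : IsHeckeSystem L ε) {B : MonoidAlgebra ℂ (Fin n → K)}
    (hB : IsSymm B) (hinv : (tensor fun _ => idem L) * B * (tensor fun _ => idem L) = B) :
    ∃ c : Comp s n → ℂ, B = ∑ k, c k • symTensor ε k := by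
  let w : Fin s → K → ℂ := fun a g => starRingEnd ℂ ((ε a).coeff g) / (ε a).coeff 1
  -- Since `e_L g e_L = ∑ w_a(g) ε_a`, this is the coefficient of `ε_{i_1} ⊗ ⋯ ⊗ ε_{i_n}` in `B`.
  -- Symmetry of `B` then makes it depend on the type of `i` only.
  let c : (Fin n → Fin s) → ℂ := fun i => ∑ x, B.coeff x * ∏ j, w (i j) (x j)
  have h1 : B = ∑ i, c i • tensor fun j => ε (i j) := by
    conv_lhs => rw [← hinv, eq_sum_single B, Finset.mul_sum, Finset.sum_mul]
    simp only [c, Finset.sum_smul]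
    rw [Finset.sum_comm]
    refine Finset.sum_congr rfl fun x _ => ?_
    rw [mul_smul_comm, smul_mul_assoc, ← tensor_single, tensor_mul, tensor_mul]
    simp only [h.idem_mul_single_mul_idem]
    rw [tensor_sum, Finset.smul_sum]
    refine Finset.sum_congr rfl fun i _ => ?_
    rw [tensor_smul, smul_smul]
  have h2 : ∀ i (σ : Equiv.Perm (Fin n)), c (i ∘ σ) = c i := fun i σ => by
    refine Fintype.sum_equiv (σ.arrowCongr (Equiv.refl _)) _ _ fun x => ?_
    congr 1
    · exact (hB σ.symm x).symm
    · exact Fintype.prod_equiv σ _ _ fun j => by simp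
  refine ⟨fun k => c (Function.surjInv wordType_surjective k), ?_⟩
  rw [sum_smul_symTensor, h1]
  refine Finset.sum_congr rfl fun i _ => ?_
  obtain ⟨σ, hσ⟩ := exists_perm_of_wordType_eq
    (Function.surjInv_eq wordType_surjective (wordType i))
  rw [← hσ, h2]

end Tensor

/-! ### Inflation to the wreath product -/

section Inflate

variable {K : Type*} [Group K] [Fintype K] {n : ℕ}

instance : Fintype (Wreath K n) := Fintype.ofEquiv _ SemidirectProduct.equivProd.symm

/-- The function `(x; σ) ↦ F x` on the wreath product. -/
def inflate (F : MonoidAlgebra ℂ (Fin n → K)) : MonoidAlgebra ℂ (Wreath K n) :=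
  ofFun fun g => F.coeff g.left

@[simp]
theorem coeff_inflate (F : MonoidAlgebra ℂ (Fin n → K)) (g : Wreath K n) :
    (inflate F).coeff g = F.coeff g.left := rfl

theorem inflate_injective :
    Function.Injective (inflate : MonoidAlgebra ℂ (Fin n → K) → _) := fun _ _ h =>
  algebra_ext fun x => congrArg (fun b => b.coeff (⟨x, 1⟩ : Wreath K n)) h

theorem inflate_sum_smul {ι : Type*} (t : Finset ι) (c : ι → ℂ)
    (F : ι → MonoidAlgebra ℂ (Fin n → K)) :
    inflate (∑ i ∈ t, c i • F i) = ∑ i ∈ t, c i • inflate (F i) :=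
  algebra_ext fun g => by simp [MonoidAlgebra.coeff_sum, Finsupp.finsetSum_apply]

/-- The permutation part of the summation variable only permutes the argument of `F'`, so symmetry
leaves a free sum over `S_n`. This is the source of the `1 / n!` in `wreathIdem`. -/
theorem inflate_mul_inflate (F : MonoidAlgebra ℂ (Fin n → K)) {F' : MonoidAlgebra ℂ (Fin n → K)}
    (hF' : IsSymm F') :
    inflate F * inflate F' = (n.factorial : ℂ) • inflate (F * F') := by
  refine algebra_ext fun g => ?_
  have h1 : ∀ x : Wreath K n, (x⁻¹ * g).left = (x.left⁻¹ * g.left) ∘ x.right := fun x => rfl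
  simp only [MonoidAlgebra.coeff_smul, Finsupp.smul_apply, smul_eq_mul, coeff_inflate,
    coeff_mul_eq_sum, h1, hF' _ _]
  refine (Fintype.sum_equiv SemidirectProduct.equivProd _
    (fun p : (Fin n → K) × Equiv.Perm (Fin n) => F.coeff p.1 * F'.coeff (p.1⁻¹ * g.left))
    fun x => rfl).trans ?_
  rw [Fintype.sum_prod_type]
  simp [Finset.mul_sum, Fintype.card_perm]

theorem card_wreath : Nat.card (Wreath K n) = Nat.card K ^ n * n.factorial := by
  rw [SemidirectProduct.card, Nat.card_fun, Nat.card_perm]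
  simp

theorem card_wreathSubgroup (L : Subgroup K) :
    Nat.card (wreathSubgroup n L) = Nat.card L ^ n * n.factorial := by
  let e : wreathSubgroup n L ≃ (Fin n → L) × Equiv.Perm (Fin n) :=
    { toFun := fun x => (fun j => ⟨x.1.left j, x.2 j⟩, x.1.right)
      invFun := fun p => ⟨⟨fun j => p.1 j, p.2⟩, fun j => (p.1 j).2⟩
      left_inv := fun _ => rfl
      right_inv := fun _ => rfl }
  rw [Nat.card_congr e, Nat.card_prod, Nat.card_fun, Nat.card_perm]
  simp

theorem factorial_ne_zero (n : ℕ) : (n.factorial : ℂ) ≠ 0 :=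
  Nat.cast_ne_zero.2 n.factorial_ne_zero

theorem idem_wreathSubgroup (L : Subgroup K) :
    idem (wreathSubgroup n L) = (n.factorial : ℂ)⁻¹ • inflate (tensor fun _ => idem L) := by
  classical
  refine algebra_ext fun g => ?_
  have h1 : g ∈ wreathSubgroup n L ↔ ∀ j, g.left j ∈ L := Iff.rfl
  simp only [coeff_idem, MonoidAlgebra.coeff_smul, Finsupp.smul_apply, coeff_inflate,
    coeff_tensor, card_wreathSubgroup, Finset.prod_ite_zero, h1, Finset.mem_univ, true_imp_iff]
  split_ifs <;> simp

/-- The idempotents of the Hecke algebra of the wreath product. -/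
def wreathIdem {s : ℕ} (ε : Fin s → MonoidAlgebra ℂ K) (k : Comp s n) :
    MonoidAlgebra ℂ (Wreath K n) :=
  (n.factorial : ℂ)⁻¹ • inflate (symTensor ε k)

theorem coeff_wreathIdem {s : ℕ} (ε : Fin s → MonoidAlgebra ℂ K) (k : Comp s n)
    (g : Wreath K n) :
    (wreathIdem ε k).coeff g = (n.factorial : ℂ)⁻¹ *
      ∑ i : Fin n → Fin s with wordType i = k, ∏ j, (ε (i j)).coeff (g.left j) := by
  rw [← coeff_symTensor]
  rfl

variable {s : ℕ} {L : Subgroup K} {ε : Fin s → MonoidAlgebra ℂ K}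

theorem IsHeckeSystem.wreathIdem_mul (h : IsHeckeSystem L ε) (k l : Comp s n) :
    wreathIdem ε k * wreathIdem ε l = if k = l then wreathIdem ε k else 0 := by
  rw [wreathIdem, wreathIdem, smul_mul_smul_comm, inflate_mul_inflate _ (isSymm_symTensor ε l),
    smul_smul, inv_mul_cancel_right₀ (factorial_ne_zero n), h.symTensor_mul_symTensor]
  split_ifs
  · rfl
  · refine algebra_ext fun g => ?_
    simp

theorem IsHeckeSystem.coeff_wreathIdem_one (h : IsHeckeSystem L ε) (k : Comp s n) :
    (wreathIdem ε k).coeff 1 =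
      (n.factorial : ℂ)⁻¹ * (multinom k * ∏ a, (ε a).coeff 1 ^ k.1 a) := by
  rw [coeff_wreathIdem]
  congr 1
  rw [← card_wordType_eq, ← nsmul_eq_mul, ← Finset.sum_const]
  refine Finset.sum_congr rfl fun i hi => ?_
  rw [← (Finset.mem_filter.1 hi).2, ← prod_word fun a => (ε a).coeff 1]
  rfl

/-- Orthogonality is inherited from the symmetrized tensors. The substance is that they span the
corner: a bi-invariant element is the pullback of a symmetric one on `K^n`. -/
theorem IsHeckeSystem.wreath (h : IsHeckeSystem L ε) :
    IsHeckeSystem (wreathSubgroup n L) (wreathIdem ε : Comp s n → _) := by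
  have hn := factorial_ne_zero n
  refine IsHeckeSystem.of_span (fun k hk => ?_) ?_ (fun k => ?_) (fun k l hkl => ?_) fun a => ?_
  · have := h.coeff_wreathIdem_one k
    rw [hk] at this
    refine mul_ne_zero (inv_ne_zero hn) (mul_ne_zero (multinom_ne_zero k) ?_) this.symm
    exact Finset.prod_ne_zero_iff.2 fun a _ => pow_ne_zero _ (h.coeff_one_ne_zero a)
  · have h1 := inflate_sum_smul Finset.univ (fun _ => 1) (symTensor (n := n) ε)
    simp only [one_smul] at h1
    simp only [wreathIdem]
    rw [← Finset.smul_sum, ← h1, sum_symTensor, h.sum_eq, idem_wreathSubgroup]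
  · rw [h.wreathIdem_mul, if_pos rfl]
  · rw [h.wreathIdem_mul, if_neg hkl]
  · set e := idem (wreathSubgroup n L)
    set b := e * a * e with hb
    have hr : b * e = b := by rw [hb, mul_assoc, idem_mul_idem]
    have hl : e * b = b := by rw [hb, ← mul_assoc, ← mul_assoc, idem_mul_idem]
    let B : MonoidAlgebra ℂ (Fin n → K) := ofFun fun x => b.coeff ⟨x, 1⟩
    have hmem : ∀ σ : Equiv.Perm (Fin n), (⟨1, σ⟩ : Wreath K n) ∈ wreathSubgroup n L :=
      fun σ j => L.one_mem
    -- Right invariance under `(1; σ)` removes the dependence on the permutation.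
    have hB : b = inflate B := by
      refine algebra_ext fun g => ?_
      rw [← coeff_mul_right_of_mul_idem hr g (hmem g.right⁻¹)]
      change _ = b.coeff _
      congr 1
      refine SemidirectProduct.ext ?_ ?_ <;> simp
    have hsymm : IsSymm B := fun σ x => by
      change b.coeff _ = b.coeff _
      rw [← coeff_mul_left_of_idem_mul hl ⟨x, 1⟩ (hmem σ⁻¹)]
      -- Left invariance becomes symmetry in the coordinates once the permutation is moved to the
      -- right and absorbed there.
      have h1 : (⟨1, σ⁻¹⟩ : Wreath K n) * ⟨x, 1⟩ = ⟨x ∘ σ, 1⟩ * ⟨1, σ⁻¹⟩ := by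
        refine SemidirectProduct.ext ?_ ?_
        · simp
          rfl
        · simp
      rw [h1, coeff_mul_right_of_mul_idem hr _ (hmem σ⁻¹)]
    obtain ⟨c, hc⟩ := h.exists_eq_sum_symTensor hsymm (inflate_injective <| by
      rw [← hB]
      conv_rhs => rw [← hr, ← hl]
      simp only [e]
      rw [idem_wreathSubgroup, hB, smul_mul_assoc, inflate_mul_inflate _ hsymm, smul_smul,
        inv_mul_cancel₀ hn, one_smul, mul_smul_comm,
        inflate_mul_inflate _ (isSymm_tensor_const _), smul_smul, inv_mul_cancel₀ hn, one_smul])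
    refine ⟨fun k => c k * n.factorial, ?_⟩
    rw [hB, hc, inflate_sum_smul]
    refine Finset.sum_congr rfl fun k _ => ?_
    rw [wreathIdem, smul_smul, mul_inv_cancel_right₀ hn]

variable {V : Fin s → Ideal (MonoidAlgebra ℂ K)}

/-- Both sides are sums over words of type `k`; replacing `ε_a(g)` by `ω_a(g)` costs the factor `∏
ε_a(1)^{k_a}`, the same for each such word. -/
theorem IsHeckeSystem.Omega_eq (h : IsHeckeSystem L ε) (hV : ∀ a, V a = Ideal.span {ε a})
    (k : Comp s n) (g : Wreath K n) :
    Omega L V k g = (wreathIdem ε k).coeff g / (wreathIdem ε k).coeff 1 := by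
  have h1 : (wreathIdem ε k).coeff g = (n.factorial : ℂ)⁻¹ *
      ((∏ a, (ε a).coeff 1 ^ k.1 a) *
        (genPoly L V g).coeff (Finsupp.equivFunOnFinite.symm k.1)) := by
    rw [coeff_wreathIdem, genPoly, coeff_prod_linear fun j a => zonal L (V a) (g.left j)]
    congr 1
    rw [Finset.mul_sum]
    refine Finset.sum_congr rfl fun i hi => ?_
    rw [← (Finset.mem_filter.1 hi).2, ← prod_word fun a => (ε a).coeff 1,
      ← Finset.prod_mul_distrib]
    refine Finset.prod_congr rfl fun j _ => ?_
    rw [hV, h.coeff_eq]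
  have h2 : (∏ a, (ε a).coeff 1 ^ k.1 a) ≠ 0 :=
    Finset.prod_ne_zero_iff.2 fun a _ => pow_ne_zero _ (h.coeff_one_ne_zero a)
  have h3 := factorial_ne_zero n
  have h4 := multinom_ne_zero k
  rw [h1, h.coeff_wreathIdem_one, Omega]
  field_simp

theorem card_ne_zero : (Nat.card K : ℂ) ≠ 0 := Nat.cast_ne_zero.2 Nat.card_pos.ne'

theorem IsHeckeSystem.dimK_eq (h : IsHeckeSystem L ε) (hV : ∀ a, V a = Ideal.span {ε a})
    (k : Comp s n) :
    (dimK V k : ℂ) = Nat.card (Wreath K n) * (wreathIdem ε k).coeff 1 := by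
  obtain rfl : V = fun a => Ideal.span {ε a} := funext hV
  have h1 : ∑ a, k.1 a = n := (Finset.mem_piAntidiag.1 k.2).1
  have h2 : (∏ a, (Module.finrank ℂ (Ideal.span {ε a}) : ℂ) ^ k.1 a) =
      (Nat.card K : ℂ) ^ n * ∏ a, (ε a).coeff 1 ^ k.1 a := by
    simp only [h.finrank_eq, mul_pow]
    rw [Finset.prod_mul_distrib, Finset.prod_pow_eq_pow_sum, h1]
  rw [h.coeff_wreathIdem_one, card_wreath, dimK]
  push_cast
  rw [h2]
  have h3 := factorial_ne_zero n
  field_simp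

end Inflate

/-! ### Double cosets -/

section DoubleCoset

variable {K : Type*} [Group K] [Fintype K]

theorem sum_coeff_mul (a b : MonoidAlgebra ℂ K) :
    ∑ g, (a * b).coeff g = (∑ g, a.coeff g) * ∑ g, b.coeff g := by
  simp only [coeff_mul_eq_sum]
  rw [Finset.sum_comm, Finset.sum_mul]
  refine Finset.sum_congr rfl fun x _ => ?_
  rw [← Finset.mul_sum]
  congr 1
  exact Fintype.sum_equiv (Equiv.mulLeft x⁻¹) _ _ fun g => rfl

theorem sum_coeff_idem (L : Subgroup K) : ∑ g, (idem L).coeff g = 1 := by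
  classical
  simp only [coeff_idem]
  rw [Finset.sum_ite, Finset.sum_const_zero, add_zero, Finset.sum_const, nsmul_eq_mul,
    ← Fintype.card_subtype, ← Nat.card_eq_fintype_card]
  exact mul_inv_cancel₀ (card_subgroup_ne_zero L)

theorem card_doubleCoset_ne_zero (L : Subgroup K) (x : K) :
    (Nat.card (DoubleCoset.doubleCoset x (L : Set K) (L : Set K)) : ℂ) ≠ 0 := by
  have : Nonempty (DoubleCoset.doubleCoset x (L : Set K) (L : Set K)) :=
    ⟨⟨x, DoubleCoset.mem_doubleCoset_self L L x⟩⟩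
  exact Nat.cast_ne_zero.2 Nat.card_pos.ne'

-- Bi-invariance makes the element constant on the double coset, and it is supported there. Total
-- mass `1`, by multiplicativity of the augmentation, fixes the constant.
open scoped Classical in
theorem coeff_idem_mul_single_mul_idem (L : Subgroup K) (x z : K) :
    (idem L * MonoidAlgebra.single x (1 : ℂ) * idem L).coeff z =
      if z ∈ DoubleCoset.doubleCoset x (L : Set K) (L : Set K) then
        (Nat.card (DoubleCoset.doubleCoset x (L : Set K) (L : Set K)) : ℂ)⁻¹ else 0 := by
  set b := idem L * MonoidAlgebra.single x (1 : ℂ) * idem L with hb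
  set D := DoubleCoset.doubleCoset x (L : Set K) (L : Set K)
  have hr : b * idem L = b := by rw [hb, mul_assoc, idem_mul_idem]
  have hl : idem L * b = b := by rw [hb, ← mul_assoc, ← mul_assoc, idem_mul_idem]
  have h1 : ∀ z, b.coeff z = if z ∈ D then b.coeff x else 0 := by
    intro z
    split_ifs with hz
    · obtain ⟨l, hlL, l', hl', rfl⟩ := DoubleCoset.mem_doubleCoset.1 hz
      rw [coeff_mul_right_of_mul_idem hr _ hl', coeff_mul_left_of_idem_mul hl _ hlL]
    · have := Fintype.ofFinite L
      rw [hb, coeff_mul_idem, Finset.sum_eq_zero, mul_zero]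
      intro h _
      rw [MonoidAlgebra.coeff_mul_single_apply, coeff_idem, if_neg, zero_mul]
      intro hmem
      exact hz (DoubleCoset.mem_doubleCoset.2
        ⟨_, hmem, (h : K)⁻¹, L.inv_mem h.2, by simp⟩)
  have h2 : ∑ z, b.coeff z = 1 := by
    rw [hb, sum_coeff_mul, sum_coeff_mul, sum_coeff_idem]
    simp [MonoidAlgebra.coeff_single, Finsupp.single_apply]
  rw [Finset.sum_congr rfl fun z _ => h1 z, Finset.sum_ite, Finset.sum_const_zero, add_zero,
    Finset.sum_const, nsmul_eq_mul, ← Fintype.card_subtype, ← Nat.card_eq_fintype_card] at h2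
  rw [h1, eq_inv_of_mul_eq_one_right h2]

theorem not_mem_of_mem_doubleCoset {L : Subgroup K} {x z : K} (hx : x ∉ L)
    (hz : z ∈ DoubleCoset.doubleCoset x (L : Set K) (L : Set K)) : z ∉ L := by
  obtain ⟨l, hl, l', hl', rfl⟩ := DoubleCoset.mem_doubleCoset.1 hz
  rwa [L.mul_mem_cancel_right hl', L.mul_mem_cancel_left hl]

end DoubleCoset

/-! ### The walk -/

section Walk

variable {K : Type*} [Group K] [Fintype K] {L : Subgroup K} {n : ℕ}

theorem bar_eq_bar {x y : Fin n → K} : bar L x = bar L y ↔ ∀ j, (x j)⁻¹ * y j ∈ L := by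
  simp only [bar, funext_iff, QuotientGroup.eq]

theorem bar_surjective : Function.Surjective (bar L : (Fin n → K) → _) := fun X =>
  ⟨fun j => (X j).out, funext fun j => (X j).out_eq⟩

/-- Each fibre of `bar` has `|L|^n` points; this turns matrix products over `(K/L)^n` into
convolutions on `K^n`. -/
theorem sum_bar [Fintype (Fin n → K ⧸ L)] (F : (Fin n → K ⧸ L) → ℂ) :
    ∑ x, F (bar L x) = (Nat.card L : ℂ) ^ n * ∑ X, F X := by
  classical
  rw [← Finset.sum_fiberwise Finset.univ (bar L), Finset.mul_sum]
  refine Finset.sum_congr rfl fun X _ => ?_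
  rw [Finset.sum_congr rfl fun x hx => congrArg F (Finset.mem_filter.1 hx).2, Finset.sum_const,
    nsmul_eq_mul, ← Fintype.card_subtype, ← Nat.card_eq_fintype_card]
  obtain ⟨y, rfl⟩ := bar_surjective X
  let e : {x // bar L x = bar L y} ≃ (Fin n → L) :=
    { toFun := fun x j => ⟨(y j)⁻¹ * x.1 j, bar_eq_bar.1 x.2.symm j⟩
      invFun := fun z => ⟨fun j => y j * z j, Eq.symm (bar_eq_bar.2 fun j => by simp)⟩
      left_inv := fun x => by simp
      right_inv := fun z => by simp }
  rw [Nat.card_congr e, Nat.card_fun]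
  simp

-- Changing representatives multiplies each coordinate of `x⁻¹ y` by elements of `L` on both sides,
-- which preserves `L` and `D₀`.
open scoped Classical in
theorem stepMatrix_bar (x₀ : K) (p : ℝ) (x y : Fin n → K) :
    stepMatrix L x₀ n p (bar L x) (bar L y) =
      if ∀ j, (x⁻¹ * y) j ∈ L then 1 - mult L x₀ * p
      else if ∃ k, (x⁻¹ * y) k ∈ DoubleCoset.doubleCoset x₀ (L : Set K) (L : Set K) ∧
        ∀ j, j ≠ k → (x⁻¹ * y) j ∈ L then p / n else 0 := by
  have key : ∀ {x x' y y' : Fin n → K}, bar L x' = bar L x → bar L y' = bar L y → ∀ j,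
      ∃ l ∈ L, ∃ l' ∈ L, (x j)⁻¹ * y j = l * ((x' j)⁻¹ * y' j) * l' := by
    intro x x' y y' hx hy j
    exact ⟨_, bar_eq_bar.1 hx.symm j, _, bar_eq_bar.1 hy j, by group⟩
  have hL : ∀ {x x' y y' : Fin n → K}, bar L x' = bar L x → bar L y' = bar L y → ∀ j,
      (x' j)⁻¹ * y' j ∈ L → (x j)⁻¹ * y j ∈ L := by
    intro x x' y y' hx hy j h
    obtain ⟨l, hl, l', hl', e⟩ := key hx hy j
    rw [e]
    exact L.mul_mem (L.mul_mem hl h) hl'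
  have hD : ∀ {x x' y y' : Fin n → K}, bar L x' = bar L x → bar L y' = bar L y → ∀ j,
      (x' j)⁻¹ * y' j ∈ DoubleCoset.doubleCoset x₀ (L : Set K) (L : Set K) →
      (x j)⁻¹ * y j ∈ DoubleCoset.doubleCoset x₀ (L : Set K) (L : Set K) := by
    intro x x' y y' hx hy j h
    obtain ⟨l, hl, l', hl', e⟩ := key hx hy j
    obtain ⟨m, hm, m', hm', e'⟩ := DoubleCoset.mem_doubleCoset.1 h
    refine DoubleCoset.mem_doubleCoset.2 ⟨l * m, L.mul_mem hl hm, m' * l', L.mul_mem hm' hl', ?_⟩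
    rw [e, e']
    group
  have hL' : (∃ x' y' : Fin n → K, bar L x' = bar L x ∧ bar L y' = bar L y ∧
      ∀ j, (x' j)⁻¹ * y' j ∈ L) ↔ ∀ j, (x⁻¹ * y) j ∈ L :=
    ⟨fun ⟨x', y', hx, hy, h⟩ j => hL hx hy j (h j), fun h => ⟨x, y, rfl, rfl, h⟩⟩
  have hD' : (∃ x' y' : Fin n → K, bar L x' = bar L x ∧ bar L y' = bar L y ∧
      ∃ k, (x' k)⁻¹ * y' k ∈ DoubleCoset.doubleCoset x₀ (L : Set K) (L : Set K) ∧
        ∀ j, j ≠ k → (x' j)⁻¹ * y' j ∈ L) ↔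
      ∃ k, (x⁻¹ * y) k ∈ DoubleCoset.doubleCoset x₀ (L : Set K) (L : Set K) ∧
        ∀ j, j ≠ k → (x⁻¹ * y) j ∈ L :=
    ⟨fun ⟨x', y', hx, hy, k, hk, h⟩ => ⟨k, hD hx hy k hk, fun j hj => hL hx hy j (h j hj)⟩,
      fun ⟨k, hk, h⟩ => ⟨x, y, rfl, rfl, k, hk, h⟩⟩
  rw [stepMatrix]
  by_cases h1 : ∀ j, (x⁻¹ * y) j ∈ L
  · rw [if_pos h1, if_pos (hL'.2 h1)]
  · rw [if_neg h1, if_neg (mt hL'.1 h1)]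
    by_cases h2 : ∃ k, (x⁻¹ * y) k ∈ DoubleCoset.doubleCoset x₀ (L : Set K) (L : Set K) ∧
        ∀ j, j ≠ k → (x⁻¹ * y) j ∈ L
    · rw [if_pos h2, if_pos (hD'.2 h2)]
    · rw [if_neg h2, if_neg (mt hD'.1 h2)]

variable {s : ℕ} {ε : Fin s → MonoidAlgebra ℂ K}

/-- The Fourier coefficient of the walk at `k`. -/
def walkEigenvalue (L : Subgroup K) (V : Fin s → Ideal (MonoidAlgebra ℂ K)) (x₀ : K) (p : ℝ)
    (k : Comp s n) : ℂ :=
  (1 - (mult L x₀ : ℂ) * (p : ℂ)) + (mult L x₀ : ℂ) * (p : ℂ) *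
    ∑ i : Fin s, ((k.1 i : ℂ) / (n : ℂ)) * starRingEnd ℂ (zonal L (V i) x₀)

theorem card_mul_coeff_idem [DecidablePred (· ∈ L)] (g : K) :
    (Nat.card L : ℂ) * (idem L).coeff g = if g ∈ L then 1 else 0 := by
  rw [coeff_idem]
  split_ifs
  · exact mul_inv_cancel₀ (card_subgroup_ne_zero L)
  · exact mul_zero _

open scoped Classical in
theorem IsHeckeSystem.coeff_tensor_idem (h : IsHeckeSystem L ε) (z : Fin n → K) :
    (if ∀ j, z j ∈ L then 1 else 0 : ℂ) =
      (Nat.card L : ℂ) ^ n * ∑ i : Fin n → Fin s, (tensor fun j => ε (i j)).coeff z := by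
  have h1 := congrArg (fun b => b.coeff z) (tensor_sum (n := n) fun _ => ε)
  simp only [coeff_tensor, h.sum_eq, MonoidAlgebra.coeff_sum, Finsupp.finsetSum_apply] at h1
  simp only [coeff_tensor]
  have h2 : (Nat.card L : ℂ) ^ n = ∏ _j : Fin n, (Nat.card L : ℂ) := by simp
  rw [← h1, h2, ← Finset.prod_mul_distrib]
  simp only [card_mul_coeff_idem, Finset.prod_ite_zero, Finset.mem_univ, true_imp_iff,
    Finset.prod_const_one]

-- The indicator factors over coordinates: `|D₀| e_L x₀ e_L` in position `k` and `|L| e_L`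
-- elsewhere, with `|D₀| = m |L|`.
open scoped Classical in
theorem IsHeckeSystem.coeff_tensor_doubleCoset (h : IsHeckeSystem L ε)
    {V : Fin s → Ideal (MonoidAlgebra ℂ K)} (hV : ∀ a, V a = Ideal.span {ε a})
    (x₀ : K) (z : Fin n → K) (k : Fin n) :
    (if z k ∈ DoubleCoset.doubleCoset x₀ (L : Set K) (L : Set K) ∧ ∀ j, j ≠ k → z j ∈ L
      then 1 else 0 : ℂ) =
      (Nat.card L : ℂ) ^ n * ((mult L x₀ : ℂ) * ∑ i : Fin n → Fin s,
        starRingEnd ℂ (zonal L (V (i k)) x₀) * (tensor fun j => ε (i j)).coeff z) := by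
  have hL := card_subgroup_ne_zero L
  have hD := card_doubleCoset_ne_zero L x₀
  set D := DoubleCoset.doubleCoset x₀ (L : Set K) (L : Set K) with hDdef
  have hw : ∀ a, starRingEnd ℂ (zonal L (V a) x₀) =
      starRingEnd ℂ ((ε a).coeff x₀) / (ε a).coeff 1 := fun a => by
    rw [hV, h.zonal_eq, map_div₀, h.conj_coeff_one]
  let c : Fin n → Fin s → ℂ := fun j a =>
    if j = k then starRingEnd ℂ ((ε a).coeff x₀) / (ε a).coeff 1 else 1
  have h1 := tensor_sum (n := n) fun j a => c j a • ε a
  simp only [tensor_smul] at h1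
  have h2 := congrArg (fun b => b.coeff z) h1
  simp only [MonoidAlgebra.coeff_sum, Finsupp.finsetSum_apply, MonoidAlgebra.coeff_smul,
    Finsupp.smul_apply, smul_eq_mul, c, Finset.prod_ite_eq', Finset.mem_univ, if_true] at h2
  simp only [hw]
  rw [← h2, coeff_tensor, mult]
  have h3 : ∀ j, (Nat.card L : ℂ) * (∑ a, (if j = k then starRingEnd ℂ ((ε a).coeff x₀) /
      (ε a).coeff 1 else 1) • ε a).coeff (z j) * (if j = k then
        (Nat.card D : ℂ) / Nat.card L else 1) =
      if (if j = k then z j ∈ D else z j ∈ L) then 1 else 0 := by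
    intro j
    split_ifs with hj hz hz
    · rw [← h.idem_mul_single_mul_idem, coeff_idem_mul_single_mul_idem, if_pos hz, ← hDdef]
      field_simp
    · rw [← h.idem_mul_single_mul_idem, coeff_idem_mul_single_mul_idem, if_neg hz, mul_zero,
        zero_mul]
    · simp only [one_smul, h.sum_eq, mul_one, card_mul_coeff_idem, if_pos hz]
    · simp only [one_smul, h.sum_eq, mul_one, card_mul_coeff_idem, if_neg hz]
  have h4 : (∏ j, if (if j = k then z j ∈ D else z j ∈ L) then 1 else 0 : ℂ) =
      if z k ∈ D ∧ ∀ j, j ≠ k → z j ∈ L then 1 else 0 := by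
    by_cases hz : z k ∈ D ∧ ∀ j, j ≠ k → z j ∈ L
    · rw [if_pos hz]
      refine Finset.prod_eq_one fun j _ => if_pos ?_
      split_ifs with hj
      · exact hj ▸ hz.1
      · exact hz.2 j hj
    · rw [if_neg hz]
      by_contra hne
      have hall : ∀ j, if j = k then z j ∈ D else z j ∈ L := fun j => by
        by_contra hj
        exact hne (Finset.prod_eq_zero (Finset.mem_univ j) (if_neg hj))
      exact hz ⟨by simpa using hall k, fun j hj => by simpa [hj] using hall j⟩
  rw [← h4, ← Finset.prod_congr rfl fun j _ => h3 j, Finset.prod_mul_distrib,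
    Finset.prod_mul_distrib, Finset.prod_const, Finset.card_univ, Fintype.card_fin,
    Finset.prod_ite_eq', if_pos (Finset.mem_univ k)]
  push_cast
  ring

theorem IsHeckeSystem.stepMatrix_eq (h : IsHeckeSystem L ε)
    {V : Fin s → Ideal (MonoidAlgebra ℂ K)} (hV : ∀ a, V a = Ideal.span {ε a})
    {x₀ : K} (hx₀ : x₀ ∉ L) (hn : 0 < n) (p : ℝ) (x y : Fin n → K) :
    (stepMatrix L x₀ n p (bar L x) (bar L y) : ℂ) =
      (Nat.card L : ℂ) ^ n *
        (∑ k : Comp s n, walkEigenvalue L V x₀ p k • symTensor ε k).coeff (x⁻¹ * y) := by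
  classical
  set z := x⁻¹ * y
  have hn0 : (n : ℂ) ≠ 0 := Nat.cast_ne_zero.2 hn.ne'
  -- Because `x₀ ∉ L`, the double coset misses `L`: the cases are disjoint and the position `k` is
  -- unique, so the case split is a sum of indicators.
  have h1 : (stepMatrix L x₀ n p (bar L x) (bar L y) : ℂ) =
      (1 - (mult L x₀ : ℂ) * p) * (if ∀ j, z j ∈ L then 1 else 0) +
      (p / n) * ∑ k, (if z k ∈ DoubleCoset.doubleCoset x₀ (L : Set K) (L : Set K) ∧
        ∀ j, j ≠ k → z j ∈ L then 1 else 0) := by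
    rw [stepMatrix_bar]
    split_ifs with hz hz'
    · rw [Finset.sum_eq_zero]
      · push_cast
        ring
      · exact fun k _ => if_neg fun hk => not_mem_of_mem_doubleCoset hx₀ hk.1 (hz k)
    · obtain ⟨k, hk⟩ := hz'
      rw [Finset.sum_eq_single k, if_pos hk]
      · push_cast
        ring
      · intro k' _ hk'
        exact if_neg fun hc => not_mem_of_mem_doubleCoset hx₀ hk.1 (hc.2 k hk'.symm)
      · simp
    · rw [Finset.sum_eq_zero fun k _ => if_neg fun hk => hz' ⟨k, hk⟩]
      simp
  -- On a word, the weights `k_a / n` amount to averaging over its `n` letters, one for each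
  -- coordinate that may move.
  have h2 : ∀ i : Fin n → Fin s, walkEigenvalue L V x₀ p (wordType i) =
      (1 - (mult L x₀ : ℂ) * p) +
        (p / n) * ∑ k, (mult L x₀ : ℂ) * starRingEnd ℂ (zonal L (V (i k)) x₀) := by
    intro i
    rw [walkEigenvalue, sum_word (fun a => (mult L x₀ : ℂ) * starRingEnd ℂ (zonal L (V a) x₀)),
      Finset.mul_sum, Finset.mul_sum]
    congr 1
    refine Finset.sum_congr rfl fun a _ => ?_
    rw [nsmul_eq_mul]
    field_simp
  rw [h1, h.coeff_tensor_idem, Finset.sum_congr rfl fun k _ =>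
    h.coeff_tensor_doubleCoset hV x₀ z k, sum_smul_symTensor]
  simp only [MonoidAlgebra.coeff_sum, Finsupp.finsetSum_apply, MonoidAlgebra.coeff_smul,
    Finsupp.smul_apply, smul_eq_mul, h2, add_mul, Finset.sum_add_distrib, mul_add, Finset.mul_sum,
    Finset.sum_mul]
  congr 1
  · exact Finset.sum_congr rfl fun i _ => by ring
  · rw [Finset.sum_comm]
    exact Finset.sum_congr rfl fun i _ => Finset.sum_congr rfl fun k _ => by ring

/-- Powers of `P` are convolution powers, and orthogonality of the symmetrized tensors raises each
coefficient to the power `N`. -/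
theorem IsHeckeSystem.stepMatrix_pow_eq (h : IsHeckeSystem L ε)
    {V : Fin s → Ideal (MonoidAlgebra ℂ K)} (hV : ∀ a, V a = Ideal.span {ε a})
    {x₀ : K} (hx₀ : x₀ ∉ L) (hn : 0 < n) (p : ℝ) [Fintype (Fin n → K ⧸ L)]
    [DecidableEq (Fin n → K ⧸ L)] (N : ℕ) (y : Fin n → K) :
    ((stepMatrix L x₀ n p ^ N) (bar L fun _ => (1 : K)) (bar L y) : ℂ) =
      (Nat.card L : ℂ) ^ n *
        (∑ k : Comp s n, walkEigenvalue L V x₀ p k ^ N • symTensor ε k).coeff y := by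
  classical
  induction N generalizing y with
  | zero =>
    simp only [pow_zero, one_smul]
    have h1 : ∑ k : Comp s n, symTensor ε k = ∑ i : Fin n → Fin s, tensor fun j => ε (i j) := by
      rw [sum_symTensor, tensor_sum]
    rw [h1, MonoidAlgebra.coeff_sum, Finsupp.finsetSum_apply, ← h.coeff_tensor_idem,
      Matrix.one_apply]
    have h2 : (bar L fun _ => (1 : K)) = bar L y ↔ ∀ j, y j ∈ L := by simp [bar_eq_bar]
    by_cases hy : ∀ j, y j ∈ L
    · rw [if_pos hy, if_pos (h2.2 hy), Complex.ofReal_one]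
    · rw [if_neg hy, if_neg (mt h2.1 hy), Complex.ofReal_zero]
  | succ N ih =>
    have hL : (Nat.card L : ℂ) ^ n ≠ 0 := pow_ne_zero _ (card_subgroup_ne_zero L)
    have h1 := sum_bar (L := L) fun X : Fin n → K ⧸ L =>
      (((stepMatrix L x₀ n p ^ N) (bar L fun _ => (1 : K)) X : ℝ) : ℂ) *
        ((stepMatrix L x₀ n p X (bar L y) : ℝ) : ℂ)
    rw [pow_succ, Matrix.mul_apply, Complex.ofReal_sum]
    simp only [Complex.ofReal_mul]
    -- Each step matrix carries a factor `|L|^n`; lifting the sum to `K^n` supplies the one that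
    -- compensates for the surplus.
    refine mul_left_cancel₀ hL (h1.symm.trans ?_)
    simp only [ih, h.stepMatrix_eq hV hx₀ hn]
    have h2 : (∑ k : Comp s n, walkEigenvalue L V x₀ p k ^ (N + 1) • symTensor ε k) =
        (∑ k : Comp s n, walkEigenvalue L V x₀ p k ^ N • symTensor ε k) *
          ∑ k : Comp s n, walkEigenvalue L V x₀ p k • symTensor ε k := by
      rw [Finset.sum_mul]
      refine Finset.sum_congr rfl fun k _ => ?_
      rw [Finset.mul_sum, Finset.sum_eq_single k, smul_mul_smul_comm,
        h.symTensor_mul_symTensor, if_pos rfl, pow_succ]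
      · intro l _ hl
        rw [smul_mul_smul_comm, h.symTensor_mul_symTensor, if_neg hl.symm, smul_zero]
      · simp
    rw [h2, coeff_mul_eq_sum, Finset.mul_sum, Finset.mul_sum]
    exact Finset.sum_congr rfl fun x _ => by ring

/-! ### Fourier coefficients -/

theorem IsHeckeSystem.dimK_mul_Omega (h : IsHeckeSystem L ε)
    {V : Fin s → Ideal (MonoidAlgebra ℂ K)} (hV : ∀ a, V a = Ideal.span {ε a})
    (k : Comp s n) (g : Wreath K n) :
    (dimK V k : ℂ) * Omega L V k g = Nat.card (Wreath K n) * (wreathIdem ε k).coeff g := by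
  rw [h.dimK_eq hV, h.Omega_eq hV, mul_assoc,
    mul_div_cancel₀ _ (h.wreath.coeff_one_ne_zero k)]

/-- The weighted `Ω_k` are exactly the idempotents `wreathIdem ε k`, so multiplying by one of them
isolates its coefficient. -/
theorem IsHeckeSystem.isFourierCoeff_iff (h : IsHeckeSystem L ε)
    {V : Fin s → Ideal (MonoidAlgebra ℂ K)} (hV : ∀ a, V a = Ideal.span {ε a})
    {x₀ : K} (hx₀ : x₀ ∉ L) (hn : 0 < n) (p : ℝ) (f : Comp s n → ℂ) :
    IsFourierCoeff L x₀ n p V f ↔ f = walkEigenvalue L V x₀ p := by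
  have hL : (Nat.card L : ℂ) ^ n ≠ 0 := pow_ne_zero _ (card_subgroup_ne_zero L)
  have hW : (Nat.card (Wreath K n) : ℂ) ≠ 0 := Nat.cast_ne_zero.2 Nat.card_pos.ne'
  have h1 : ∀ g : Wreath K n, nuTilde L x₀ n p g =
      (∑ k : Comp s n, walkEigenvalue L V x₀ p k • wreathIdem ε k).coeff g := by
    intro g
    rw [nuTilde, orbitPt, h.stepMatrix_eq hV hx₀ hn, mul_div_mul_left _ _ hL]
    have : (fun _ => 1 : Fin n → K)⁻¹ * g.left = g.left := by
      funext j
      simp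
    rw [this]
    simp only [wreathIdem, MonoidAlgebra.coeff_sum, Finsupp.finsetSum_apply,
      MonoidAlgebra.coeff_smul, Finsupp.smul_apply, smul_eq_mul, coeff_inflate, Finset.sum_div]
    exact Finset.sum_congr rfl fun k _ => by ring
  have h2 : ∀ g : Wreath K n,
      ∑ k : Comp s n, ((dimK V k : ℂ) / (Nat.card (Wreath K n) : ℂ)) * f k * Omega L V k g =
        (∑ k : Comp s n, f k • wreathIdem ε k).coeff g := by
    intro g
    simp only [MonoidAlgebra.coeff_sum, Finsupp.finsetSum_apply,
      MonoidAlgebra.coeff_smul, Finsupp.smul_apply, smul_eq_mul]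
    refine Finset.sum_congr rfl fun k _ => ?_
    rw [← mul_div_cancel_left₀ ((wreathIdem ε k).coeff g) hW, ← h.dimK_mul_Omega hV]
    ring
  have h3 : ∀ (f : Comp s n → ℂ) (l : Comp s n),
      (∑ k, f k • wreathIdem ε k) * wreathIdem ε l = f l • wreathIdem ε l := by
    intro f l
    rw [Finset.sum_mul, Finset.sum_eq_single l, smul_mul_assoc, h.wreathIdem_mul, if_pos rfl]
    · intro k _ hk
      rw [smul_mul_assoc, h.wreathIdem_mul, if_neg hk, smul_zero]
    · simp
  simp only [IsFourierCoeff, h1, h2]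
  refine ⟨fun hf => funext fun l => ?_, fun hf => by simp [hf]⟩
  have h4 := congrArg (· * wreathIdem ε l) (algebra_ext hf)
  simp only [h3] at h4
  exact (smul_left_injective ℂ (h.wreath.ne_zero l) h4).symm

/-- In terms of symmetrized tensors, `d_k Ω_k` carries the factor `|K|^n` and the `N`-step law the
factor `|L|^n`, whence `r^{-n}`. -/
theorem IsHeckeSystem.nu_eq (h : IsHeckeSystem L ε)
    {V : Fin s → Ideal (MonoidAlgebra ℂ K)} (hV : ∀ a, V a = Ideal.span {ε a})
    {x₀ : K} (hx₀ : x₀ ∉ L) (hn : 0 < n) (p : ℝ) (N : ℕ) (g : Wreath K n) :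
    (nu L x₀ n p N (orbitPt L g) : ℂ) =
      (1 / ((Nat.card K : ℂ) / (Nat.card L : ℂ)) ^ n) *
        ∑ k : Comp s n, (dimK V k : ℂ) * walkEigenvalue L V x₀ p k ^ N * Omega L V k g := by
  classical
  let _ : Fintype (K ⧸ L) := Fintype.ofFinite _
  have hL : (Nat.card L : ℂ) ^ n ≠ 0 := pow_ne_zero _ (card_subgroup_ne_zero L)
  have hK : (Nat.card K : ℂ) ^ n ≠ 0 := pow_ne_zero _ card_ne_zero
  have h1 : (nu L x₀ n p N (orbitPt L g) : ℂ) = (Nat.card L : ℂ) ^ n *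
      (∑ k : Comp s n, walkEigenvalue L V x₀ p k ^ N • symTensor ε k).coeff g.left := by
    rw [← h.stepMatrix_pow_eq hV hx₀ hn p N g.left, nu, orbitPt]
  have h2 : ∀ k : Comp s n, (dimK V k : ℂ) * Omega L V k g =
      (Nat.card K : ℂ) ^ n * (symTensor ε k).coeff g.left := by
    intro k
    have h3 := factorial_ne_zero n
    rw [h.dimK_mul_Omega hV, card_wreath, wreathIdem]
    simp only [MonoidAlgebra.coeff_smul, Finsupp.smul_apply, smul_eq_mul, coeff_inflate]
    push_cast
    field_simp
  rw [h1]
  simp only [MonoidAlgebra.coeff_sum, Finsupp.finsetSum_apply,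
    MonoidAlgebra.coeff_smul, Finsupp.smul_apply, smul_eq_mul, Finset.mul_sum]
  refine Finset.sum_congr rfl fun k _ => ?_
  rw [mul_right_comm, h2, div_pow]
  field_simp

end Walk

end UrnWalk

end

theorem theorem4p1 {K : Type*} [Group K] [Finite K] (L : Subgroup K)
    (hKL : UrnWalk.IsGelfandPair L) {s : ℕ} (V : Fin s → Ideal (MonoidAlgebra ℂ K))
    (hV : UrnWalk.IsIrredDecomp L V) (x₀ : K) (hx₀ : x₀ ∉ L) (n : ℕ) (hn : 0 < n) (p : ℝ)
    (hp₀ : 0 ≤ UrnWalk.mult L x₀ * p) (hp₁ : UrnWalk.mult L x₀ * p ≤ 1) :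
    -- the functions `Ω_k` are the zonal spherical functions of the Gelfand pair `(K ≀ S_n, L ≀ S_n)`
    (UrnWalk.IsGelfandPair (UrnWalk.wreathSubgroup n L) ∧
      ∃ W : UrnWalk.Comp s n → Ideal (MonoidAlgebra ℂ (UrnWalk.Wreath K n)),
        UrnWalk.IsIrredDecomp (UrnWalk.wreathSubgroup n L) W ∧
        ∀ k, UrnWalk.zonal (UrnWalk.wreathSubgroup n L) (W k) = UrnWalk.Omega L V k ∧
          Module.finrank ℂ (W k) = UrnWalk.dimK V k) ∧
    -- Fourier coefficients exist, are given by the formula, and give the `N`-step law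
    (∃ f : UrnWalk.Comp s n → ℂ, UrnWalk.IsFourierCoeff L x₀ n p V f) ∧
    ∀ f : UrnWalk.Comp s n → ℂ, UrnWalk.IsFourierCoeff L x₀ n p V f →
      (∀ k : UrnWalk.Comp s n,
        f k = (1 - (UrnWalk.mult L x₀ : ℂ) * (p : ℂ)) +
          (UrnWalk.mult L x₀ : ℂ) * (p : ℂ) *
            ∑ i : Fin s, ((k.1 i : ℂ) / (n : ℂ)) *
              starRingEnd ℂ (UrnWalk.zonal L (V i) x₀)) ∧
      ∀ (N : ℕ) (g : UrnWalk.Wreath K n),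
        (UrnWalk.nu L x₀ n p N (UrnWalk.orbitPt L g) : ℂ) =
          (1 / ((Nat.card K : ℂ) / (Nat.card L : ℂ)) ^ n) *
            ∑ k : UrnWalk.Comp s n,
              (UrnWalk.dimK V k : ℂ) * f k ^ N * UrnWalk.Omega L V k g := by
  have := Fintype.ofFinite K
  obtain ⟨ε, h, hVε⟩ := hV.exists_heckeSystem hKL
  refine ⟨⟨h.wreath.isGelfandPair, fun k => Ideal.span {UrnWalk.wreathIdem ε k},
    h.wreath.isIrredDecomp, fun k => ⟨funext fun g => ?_, ?_⟩⟩,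
    ⟨_, (h.isFourierCoeff_iff hVε hx₀ hn p _).2 rfl⟩, fun f hf => ?_⟩
  · rw [h.wreath.zonal_eq, h.Omega_eq hVε]
  · have h1 := h.wreath.finrank_eq k
    rw [← h.dimK_eq hVε] at h1
    exact_mod_cast h1
  · obtain rfl := (h.isFourierCoeff_iff hVε hx₀ hn p f).1 hf
    exact ⟨fun k => rfl, fun N g => h.nu_eq hVε hx₀ hn p N g⟩
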